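/- Let $M$ be a compact $C^\infty$ manifold without boundary of dimension $d$ with a $C^\infty$ Riemannian metric $g$, let $1\le n\le d$, and let $T^nM=TM\oplus\cdots\oplus TM$ ($n$ summands), with points $(x,v)=(x,v_1,\dots,v_n)$. Smooth $n$-forms are regarded as functions on $T^nM$. For smooth $f:T^nM\to\mathbb R$ let $\nabla_vf=(\nabla_{v_1}f,\dots,\nabla_{v_n}f)$, where $\nabla_{v_i}f\in T_xM$ is the $g$-gradient of $f$ in the variable $v_i$. Let $\mathrm{vol}_n(x,v)=\sup\omega_x(v_1,\dots,v_n)$ over all smooth $n$-forms $\omega$ of comass at most $1$ (that is, $|\omega_y(w_1,\dots,w_n)|\le 1$ for all $y\in M$ and all $w_i\in T_yM$ with $|w_i|_g\le 1$). A *holonomic measure* is a Borel probability measure $\mu$ on $T^nM$ with $\int \mathrm{vol}_n\,d\mu<\infty$ and $\int d\omega\,d\mu=0$ for all smooth $(n-1)$-forms $\omega$. Its homology class is the functional $\omega\mapsto\int\omega\,d\mu$ on closed $n$-forms. A *mild distribution* is a distribution $\eta$ on $T^nM$ such that $\sum_i\langle\eta,\psi_i\omega\rangle$ converges absolutely for every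 smooth $n$-form $\omega$ on $M$ and every countable, locally finite, smooth partition of unity $(\psi_i)$ on $T^nM$ with compact supports. A *homology preserving variation* of $\mu$ is a family $(\mu_t)_{t\ge0}$ of holonomic measures with $\mu_0=\mu$, all having the same homology class, for which there is a mild distribution $\eta$ with $\frac{d}{dt}\big|_{t=0^+}\int f\,d\mu_t=\langle\eta,f\rangle$ for all $f\in C_c^\infty(T^nM)$. Let $L\in C^\infty(T^nM)$ and $A_L(\mu)=\int L\,d\mu$. The measure $\mu$ is *critical for $A_L$ within its homology class* if $L\in L^1(\mu)$ and $\frac{d}{dt}\big|_{t=0^+}A_L(\mu_t)\ge0$ for every homology preserving variation of $\mu$ such that $L\in L^1(\mu_t)$ for all $t\ge0$ and this one-sided derivative exists. Let $\mathcal H$ be the Hilbert space of sections $u$ over $\operatorname{supp}\mu$, $u(x,v)=(u_1,\dots,u_n)\in T^n_xM$, with norm $\left(\int\sum_i g(u_i,u_i)\,d\mu\right)^{1/2}<\infty$. **Proposition.** Let $\mu$ be a holonomic measure that is critical for $A_L$ within its homology class. Assume that $\nabla_vL$ and the gradients $\nabla_v\omega$ of all closed smooth $n$-forms $\omega$ belong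 to $\mathcal H$. Then there is a sequence $(\omega^i)_i$ of smooth closed $n$-forms on $M$, $d\omega^i=0$, such that $$\nabla_vL|_{\operatorname{supp}\mu}=\lim_{i\to\infty}\nabla_v\omega^i\quad\text{in }\mathcal H .$$ -/

import Mathlib

open Set Filter Topology MeasureTheory Manifold Bundle
open scoped ContDiff

noncomputable section

/-- The model space `ℝᵈ`. -/
abbrev Rd (d : ℕ) : Type := EuclideanSpace ℝ (Fin d)

/-! ### The bundle `TⁿM = TM ⊕ ⋯ ⊕ TM` -/

section Bundle

variable (d n : ℕ) {M : Type*} [TopologicalSpace M] [ChartedSpace (Rd d) M]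

/-- The linear map `(v₁, …, vₙ) ↦ (A v₁, …, A vₙ)`. -/
def diagMap {d : ℕ} (n : ℕ) (A : Rd d →L[ℝ] Rd d) :
    (Fin n → Rd d) →L[ℝ] (Fin n → Rd d) :=
  ContinuousLinearMap.pi fun i => A.comp (ContinuousLinearMap.proj i)

@[simp] theorem diagMap_apply {d n : ℕ} (A : Rd d →L[ℝ] Rd d) (v : Fin n → Rd d) (i : Fin n) :
    diagMap n A v i = A (v i) := rfl

theorem contDiff_diagMap (d n : ℕ) : ContDiff ℝ ∞ (diagMap (d := d) n) := by
  have h : diagMap (d := d) n = fun A => ∑ i : Fin n,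
      (ContinuousLinearMap.single ℝ (fun _ : Fin n => Rd d) i).comp
        (A.comp (ContinuousLinearMap.proj i)) := by
    funext A
    ext1 v
    funext j
    simp [diagMap, Finset.sum_apply, Pi.single_apply]
  rw [h]
  exact ContDiff.sum fun i _ =>
    contDiff_const.clm_comp (contDiff_id.clm_comp contDiff_const)

variable (M) in
/-- The vector bundle core of `TⁿM`: its transition maps are those of the tangent bundle, acting
on each of the `n` vectors. -/
def tnCore [IsManifold (𝓡 d) 1 M] :
    VectorBundleCore ℝ M (Fin n → Rd d) (atlas (Rd d) M) where
  baseSet := (tangentBundleCore (𝓡 d) M).baseSet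
  isOpen_baseSet := (tangentBundleCore (𝓡 d) M).isOpen_baseSet
  indexAt := (tangentBundleCore (𝓡 d) M).indexAt
  mem_baseSet_at := (tangentBundleCore (𝓡 d) M).mem_baseSet_at
  coordChange i j x := diagMap n ((tangentBundleCore (𝓡 d) M).coordChange i j x)
  coordChange_self i x hx v := by
    funext a
    exact (tangentBundleCore (𝓡 d) M).coordChange_self i x hx (v a)
  continuousOn_coordChange i j :=
    (contDiff_diagMap d n).continuous.comp_continuousOn
      ((tangentBundleCore (𝓡 d) M).continuousOn_coordChange i j)
  coordChange_comp i j k x hx v := by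
    funext a
    exact (tangentBundleCore (𝓡 d) M).coordChange_comp i j k x hx (v a)

/-- The fibre `TⁿₓM`: `n`-tuples of tangent vectors at `x`. -/
def TnSpace (x : M) : Type := Fin n → TangentSpace (𝓡 d) x

instance (x : M) : TopologicalSpace (TnSpace d n x) :=
  inferInstanceAs (TopologicalSpace (Fin n → TangentSpace (𝓡 d) x))
instance (x : M) : AddCommGroup (TnSpace d n x) :=
  inferInstanceAs (AddCommGroup (Fin n → TangentSpace (𝓡 d) x))
instance (x : M) : Module ℝ (TnSpace d n x) :=
  inferInstanceAs (Module ℝ (Fin n → TangentSpace (𝓡 d) x))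

variable (M) in
/-- The total space of `TⁿM`, with points `⟨x, v⟩`, `x : M`, `v = (v₁, …, vₙ)`, `vᵢ ∈ TₓM`. -/
abbrev TnM : Type _ := TotalSpace (Fin n → Rd d) (fun x : M => TnSpace d n x)

variable (M) in
/-- The model with corners of the manifold `TⁿM`. -/
abbrev tnModel : ModelWithCorners ℝ (Rd d × (Fin n → Rd d)) (ModelProd (Rd d) (Fin n → Rd d)) :=
  (𝓡 d).prod 𝓘(ℝ, Fin n → Rd d)

variable [IsManifold (𝓡 d) ∞ M]

instance : TopologicalSpace (TnM d n M) :=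
  haveI : IsManifold (𝓡 d) 1 M := .of_le (n := ∞) (by norm_num)
  inferInstanceAs (TopologicalSpace (tnCore d n M).TotalSpace)

instance : FiberBundle (Fin n → Rd d) (fun x : M => TnSpace d n x) :=
  haveI : IsManifold (𝓡 d) 1 M := .of_le (n := ∞) (by norm_num)
  inferInstanceAs (FiberBundle (Fin n → Rd d) (tnCore d n M).Fiber)

instance : VectorBundle ℝ (Fin n → Rd d) (fun x : M => TnSpace d n x) :=
  haveI : IsManifold (𝓡 d) 1 M := .of_le (n := ∞) (by norm_num)
  inferInstanceAs (VectorBundle ℝ (Fin n → Rd d) (tnCore d n M).Fiber)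

instance : ContMDiffVectorBundle ∞ (Fin n → Rd d) (fun x : M => TnSpace d n x) (𝓡 d) := by
  have : IsManifold (𝓡 d) 1 M := .of_le (n := ∞) (by norm_num)
  have h1 : (tangentBundleCore (𝓡 d) M).IsContMDiff (𝓡 d) ∞ := by
    have : IsManifold (𝓡 d) (∞ + 1) M := by simpa
    exact tangentBundleCore.isContMDiff
  have : (tnCore d n M).IsContMDiff (𝓡 d) ∞ :=
    ⟨fun i j => (contDiff_diagMap d n).contMDiff.comp_contMDiffOn
      (h1.contMDiffOn_coordChange i j)⟩
  exact (tnCore d n M).instContMDiffVectorBundle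

instance : MeasurableSpace (TnM d n M) := borel _
instance : BorelSpace (TnM d n M) := ⟨rfl⟩

theorem isManifold_tnM : IsManifold (tnModel d n) ∞ (TnM d n M) := inferInstance

end Bundle

/-! ### Differential forms -/

section Forms

variable {d : ℕ} {M : Type*} [TopologicalSpace M] [ChartedSpace (Rd d) M]

/-- The coordinate expression, in the preferred chart `φ` at `x`, of a field `α` of alternating
`k`-forms on `M`: the pullback `(φ⁻¹)^* α`. -/
def formInChart {k : ℕ} (α : ∀ x : M, TangentSpace (𝓡 d) x [⋀^Fin k]→L[ℝ] ℝ) (x : M) (y : Rd d) :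
    Rd d [⋀^Fin k]→L[ℝ] ℝ :=
  (α ((extChartAt (𝓡 d) x).symm y)).compContinuousLinearMap
    (mfderiv 𝓘(ℝ, Rd d) (𝓡 d) (extChartAt (𝓡 d) x).symm y :
      Rd d →L[ℝ] TangentSpace (𝓡 d) ((extChartAt (𝓡 d) x).symm y))

variable (d M) in
/-- `Ωᵏ(M)`: smooth differential `k`-forms on `M`. -/
structure DiffForm (k : ℕ) where
  toFun : ∀ x : M, TangentSpace (𝓡 d) x [⋀^Fin k]→L[ℝ] ℝ
  smooth : ∀ x : M, ContDiffOn ℝ ∞ (formInChart toFun x) (extChartAt (𝓡 d) x).target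

/-- The value at `x` of the exterior derivative `dα`, computed in the preferred chart `φ` at `x`:
`(dα)ₓ = φ^* (d ((φ⁻¹)^* α))`. -/
def DiffForm.extD {k : ℕ} (α : DiffForm d M k) (x : M) :
    TangentSpace (𝓡 d) x [⋀^Fin (k + 1)]→L[ℝ] ℝ :=
  (extDeriv (formInChart α.toFun x) (extChartAt (𝓡 d) x x)).compContinuousLinearMap
    (mfderiv (𝓡 d) 𝓘(ℝ, Rd d) (extChartAt (𝓡 d) x) x : TangentSpace (𝓡 d) x →L[ℝ] Rd d)

/-- `dα = 0`. -/
def DiffForm.IsClosed {k : ℕ} (α : DiffForm d M k) : Prop := ∀ x : M, α.extD x = 0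

/-- A field of alternating `n`-forms regarded as a function on `TⁿM`. -/
def formFun {n : ℕ} (α : ∀ x : M, TangentSpace (𝓡 d) x [⋀^Fin n]→L[ℝ] ℝ) (p : TnM d n M) : ℝ :=
  α p.proj p.snd

end Forms

/-! ### Distributions -/

section Distributions

variable {E H : Type*} [NormedAddCommGroup E] [NormedSpace ℝ E] [TopologicalSpace H]
  (I : ModelWithCorners ℝ E H) (P : Type*) [TopologicalSpace P] [ChartedSpace H P]

/-- `C_c^∞(P)`. -/
def testFunctions : Submodule ℝ (P → ℝ) where
  carrier := {f | ContMDiff I 𝓘(ℝ, ℝ) ∞ f ∧ HasCompactSupport f}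
  add_mem' hf hg := ⟨hf.1.add hg.1, hf.2.add hg.2⟩
  zero_mem' := ⟨contMDiff_const, HasCompactSupport.zero⟩
  smul_mem' c _ hf := ⟨(contMDiff_const (c := c)).mul hf.1, hf.2.smul_left (f := fun _ => c)⟩

variable {I P}

/-- A linear functional on `C_c^∞(P)` is a distribution if in every smooth chart, on test functions
supported in a given compact set `K`, it is bounded by a constant times the supremum of the
derivatives up to some order `N`, with the constant and `N` depending only on the chart and `K`. -/
def IsDistribution (η : testFunctions I P →ₗ[ℝ] ℝ) : Prop :=
  ∀ e ∈ IsManifold.maximalAtlas I ∞ P, ∀ K : Set P, IsCompact K → K ⊆ e.source →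
    ∃ (N : ℕ) (C : ℝ), ∀ f : testFunctions I P, tsupport (f : P → ℝ) ⊆ K →
      ∀ B : ℝ, 0 ≤ B →
        (∀ i ≤ N, ∀ x ∈ K,
          ‖iteratedFDeriv ℝ i ((f : P → ℝ) ∘ (e.extend I).symm) (e.extend I x)‖ ≤ B) →
        |η f| ≤ C * B

end Distributions

/-! ### Mild and holonomic measures, variations, criticality -/

section Holonomic

variable {d : ℕ} {M : Type*} [TopologicalSpace M] [ChartedSpace (Rd d) M] [IsManifold (𝓡 d) ∞ M]

/-- A mild distribution on `TⁿM`: for every smooth `n`-form `α` and every (smooth, locally finite,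
countable) partition of unity `(ψᵢ)` by compactly supported functions, the series
`∑ᵢ ⟨η, ψᵢ α⟩` converges absolutely. -/
def IsMildDistribution {n : ℕ} (η : testFunctions (tnModel d n) (TnM d n M) →ₗ[ℝ] ℝ) : Prop :=
  IsDistribution η ∧
  ∀ (α : DiffForm d M n) (ψ : SmoothPartitionOfUnity ℕ (tnModel d n) (TnM d n M) univ),
    (∀ i, HasCompactSupport (ψ i)) →
    ∀ φ : ℕ → testFunctions (tnModel d n) (TnM d n M),
      (∀ i p, (φ i : TnM d n M → ℝ) p = ψ i p * formFun α.toFun p) →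
      Summable fun i => |η (φ i)|

/-- The homology class `ρ(μ)` of a measure `μ`, as an element of the dual of the space of closed
`n`-forms: `⟨ρ(μ), α⟩ = ∫ α dμ`. -/
def homologyClass {n : ℕ} (μ : Measure (TnM d n M)) :
    {α : DiffForm d M n // α.IsClosed} → ℝ :=
  fun α => ∫ p, formFun α.1.toFun p ∂μ

variable [RiemannianBundle (fun x : M => TangentSpace (𝓡 d) x)]

/-- `α` has comass norm at most `1`. -/
def ComassLEOne {n : ℕ} (α : DiffForm d M n) : Prop :=
  ∀ (x : M) (v : Fin n → TangentSpace (𝓡 d) x), (∀ i, ‖v i‖ ≤ 1) → |α.toFun x v| ≤ 1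

/-- The volume function `vol_n(x, v) = sup {αₓ(v) : ‖α‖ ≤ 1}`. -/
def volFun {n : ℕ} (p : TnM d n M) : ENNReal :=
  ⨆ (α : DiffForm d M n) (_ : ComassLEOne α), ENNReal.ofReal (formFun α.toFun p)

/-- A positive Borel measure on `TⁿM` is mild if its mass `∫ vol_n dμ` is finite. -/
def IsMild {n : ℕ} (μ : Measure (TnM d n M)) : Prop := ∫⁻ p, volFun p ∂μ < ⊤

/-- Holonomic measures on `TⁿM`, `n = k + 1`: mild probability measures that annihilate the exact
forms `dα`, `α ∈ Ωⁿ⁻¹(M)`. -/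
structure IsHolonomic {k : ℕ} (μ : Measure (TnM d (k + 1) M)) : Prop where
  prob : IsProbabilityMeasure μ
  mild : IsMild μ
  exact_zero : ∀ α : DiffForm d M k, ∫ p, formFun α.extD p ∂μ = 0

/-- A variation of `μ`: a family `(μ_t)_{t ≥ 0}` of holonomic measures with `μ_0 = μ`,
differentiable at `0` (from the right), the derivative being a mild distribution. Values of `ν` at
negative times are irrelevant. -/
structure IsVariation {k : ℕ} (μ : Measure (TnM d (k + 1) M))
    (ν : ℝ → Measure (TnM d (k + 1) M)) : Prop where
  holonomic : ∀ t, 0 ≤ t → IsHolonomic (ν t)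
  initial : ν 0 = μ
  differentiable : ∃ η : testFunctions (tnModel d (k + 1)) (TnM d (k + 1) M) →ₗ[ℝ] ℝ,
    IsMildDistribution η ∧
    ∀ f : testFunctions (tnModel d (k + 1)) (TnM d (k + 1) M),
      HasDerivWithinAt (fun t => ∫ p, (f : TnM d (k + 1) M → ℝ) p ∂(ν t)) (η f) (Ici 0) 0

/-- `μ` is critical for the action `A_L(μ) = ∫ L dμ` within its homology class: `A_L(μ)` is defined
and `d/dt|_{t=0+} A_L(μ_t) ≥ 0` for every homology preserving variation `(μ_t)` of `μ` along which
the action is defined and has a one-sided derivative at `0`. -/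
def IsCriticalInHomologyClass {k : ℕ} (L : TnM d (k + 1) M → ℝ)
    (μ : Measure (TnM d (k + 1) M)) : Prop :=
  Integrable L μ ∧
  ∀ ν : ℝ → Measure (TnM d (k + 1) M), IsVariation μ ν →
    (∀ t, 0 ≤ t → homologyClass (ν t) = homologyClass μ) →
    (∀ t, 0 ≤ t → Integrable L (ν t)) →
    ∀ a : ℝ, HasDerivWithinAt (fun t => ∫ p, L p ∂(ν t)) a (Ici 0) 0 → 0 ≤ a

/-! ### Vertical gradients -/

instance (x : M) : FiniteDimensional ℝ (TangentSpace (𝓡 d) x) :=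
  inferInstanceAs (FiniteDimensional ℝ (Rd d))

instance (x : M) : CompleteSpace (TangentSpace (𝓡 d) x) := FiniteDimensional.complete ℝ _

/-- The vertical gradient `∇_v f = (∇_{v₁} f, …, ∇_{vₙ} f)` at `p = (x, v₁, …, vₙ)`: `∇_{vᵢ} f ∈ TₓM`
is the gradient, with respect to the Riemannian metric on `TₓM`, of
`w ↦ f (x, v₁, …, vᵢ₋₁, w, vᵢ₊₁, …, vₙ)` at `w = vᵢ`. -/
def vertGrad {n : ℕ} (f : TnM d n M → ℝ) (p : TnM d n M) :
    Fin n → TangentSpace (𝓡 d) p.proj :=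
  fun i => gradient (fun w : TangentSpace (𝓡 d) p.proj =>
    f ⟨p.proj, Function.update (β := fun _ => TangentSpace (𝓡 d) p.proj) p.snd i w⟩) (p.snd i)

/-- The squared norm `∫ g(u, u) dμ` of a section `u` of `TⁿM` over `TⁿM`. -/
def sqNormH {n : ℕ} (μ : Measure (TnM d n M))
    (u : ∀ p : TnM d n M, Fin n → TangentSpace (𝓡 d) p.proj) : ENNReal :=
  ∫⁻ p, ENNReal.ofReal (∑ i, ‖u p i‖ ^ 2) ∂μ

end Holonomic

end

noncomputable section

section Alternating

/-- A map into alternating forms is smooth if all its evaluations are. -/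
theorem contDiffOn_alternating {d n : ℕ} {E : Type*} [NormedAddCommGroup E] [NormedSpace ℝ E]
    {f : E → Rd d [⋀^Fin n]→L[ℝ] ℝ} {s : Set E}
    (h : ∀ v : Fin n → Rd d, ContDiffOn ℝ ∞ (fun y => f y v) s) : ContDiffOn ℝ ∞ f s := by
  let b := (EuclideanSpace.basisFun (Fin d) ℝ).toBasis
  let S : (Rd d [⋀^Fin n]→L[ℝ] ℝ) →ₗ[ℝ] ((Fin n → Fin d) → ℝ) :=
    { toFun := fun a J => a fun i => b (J i)
      map_add' := fun _ _ => rfl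
      map_smul' := fun _ _ => rfl }
  have hS : LinearMap.ker S = ⊥ := by
    refine LinearMap.ker_eq_bot.2 fun a c hac => ?_
    have : a.toAlternatingMap = c.toAlternatingMap := by
      refine b.ext_alternating fun v _ => ?_
      exact congrFun hac v
    ext v
    exact congrArg (fun m : Rd d [⋀^Fin n]→ₗ[ℝ] ℝ => m v) this
  obtain ⟨T, hT⟩ := LinearMap.exists_leftInverse_of_injective S hS
  have hf : f = fun y => T.toContinuousLinearMap (S (f y)) := by
    funext y
    exact (LinearMap.congr_fun hT (f y)).symm
  rw [hf]
  refine T.toContinuousLinearMap.contDiff.comp_contDiffOn ?_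
  exact contDiffOn_pi.2 fun J => h _

theorem contDiffOn_compContinuousLinearMap {d n : ℕ} {E F : Type*} [NormedAddCommGroup E]
    [NormedSpace ℝ E] [NormedAddCommGroup F] [NormedSpace ℝ F]
    (β : F [⋀^Fin n]→L[ℝ] ℝ) {A : E → Rd d →L[ℝ] F} {s : Set E} (hA : ContDiffOn ℝ ∞ A s) :
    ContDiffOn ℝ ∞ (fun y => β.compContinuousLinearMap (A y)) s := by
  refine contDiffOn_alternating fun v => ?_
  refine β.toContinuousMultilinearMap.contDiff.comp_contDiffOn ?_
  exact contDiffOn_pi.2 fun i => hA.clm_apply contDiffOn_const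

/-- Finitely many constant forms and tuples of basis vectors determine all alternating forms. -/
theorem exists_alternating_expansion (d n : ℕ) :
    ∃ β : (Fin n → Fin d) → Rd d [⋀^Fin n]→L[ℝ] ℝ,
      ∀ (a : Rd d [⋀^Fin n]→L[ℝ] ℝ) (v : Fin n → Rd d),
        a v = ∑ J, β J v * a fun i => EuclideanSpace.basisFun (Fin d) ℝ (J i) := by
  let m : (Fin n → Fin d) → ContinuousMultilinearMap ℝ (fun _ : Fin n => Rd d) ℝ := fun J =>
    (ContinuousMultilinearMap.mkPiAlgebra ℝ (Fin n) ℝ).compContinuousLinearMap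
      fun i => EuclideanSpace.proj (J i)
  refine ⟨fun J => ((n.factorial : ℝ)⁻¹) • ContinuousMultilinearMap.alternatization (m J), ?_⟩
  intro a v
  have h1 : ∀ v : Fin n → Rd d,
      a v = ∑ J, m J v * a fun i => EuclideanSpace.basisFun (Fin d) ℝ (J i) := by
    intro v
    have hv : v = fun i => ∑ j, v i j • EuclideanSpace.basisFun (Fin d) ℝ j := by
      funext i
      exact ((EuclideanSpace.basisFun (Fin d) ℝ).sum_repr (v i)).symm
    conv_lhs => rw [hv]
    rw [ContinuousAlternatingMap.map_sum]
    refine Finset.sum_congr rfl fun J _ => ?_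
    have := a.toMultilinearMap.map_smul_univ (fun i => v i (J i))
      (fun i => EuclideanSpace.basisFun (Fin d) ℝ (J i))
    simpa [m] using this
  have h2 : (n.factorial : ℝ) * a v = ∑ σ : Equiv.Perm (Fin n), Equiv.Perm.sign σ • a (v ∘ σ) := by
    have : ∀ σ : Equiv.Perm (Fin n), Equiv.Perm.sign σ • a (v ∘ σ) = a v := by
      intro σ
      have := a.toAlternatingMap.map_perm v σ
      have h' : a (v ∘ σ) = Equiv.Perm.sign σ • a v := this
      rw [h', smul_smul, Int.units_mul_self, one_smul]
    simp [this, Fintype.card_perm]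
  have hn : (n.factorial : ℝ) ≠ 0 := by positivity
  have h3 : a v = (n.factorial : ℝ)⁻¹ *
      ∑ σ : Equiv.Perm (Fin n), Equiv.Perm.sign σ • a (v ∘ σ) := by
    rw [← h2]
    field_simp
  rw [h3]
  simp_rw [h1 (v ∘ _), Finset.smul_sum]
  rw [Finset.sum_comm, Finset.mul_sum]
  refine Finset.sum_congr rfl fun J _ => ?_
  rw [ContinuousAlternatingMap.smul_apply, ContinuousMultilinearMap.alternatization_apply_apply,
    smul_eq_mul, mul_assoc, Finset.sum_mul]
  simp_rw [smul_mul_assoc]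

end Alternating

theorem minSmoothness_two_le : minSmoothness ℝ 2 ≤ (∞ : WithTop ℕ∞) := by
  rw [minSmoothness_of_isRCLikeNormedField]
  exact WithTop.coe_le_coe.2 (le_top : (2 : ℕ∞) ≤ ⊤)

section ManifoldForms

variable {d : ℕ} {M : Type*} [TopologicalSpace M] [ChartedSpace (Rd d) M]
  [IsManifold (𝓡 d) ∞ M]

theorem isManifold_one (d : ℕ) (M : Type*) [TopologicalSpace M] [ChartedSpace (Rd d) M]
    [IsManifold (𝓡 d) ∞ M] : IsManifold (𝓡 d) 1 M := .of_le (n := ∞) (by norm_num)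

theorem contMDiffAt_extChartAt_symm {c : M} {y : Rd d} (hy : y ∈ (extChartAt (𝓡 d) c).target) :
    ContMDiffAt 𝓘(ℝ, Rd d) (𝓡 d) ∞ (extChartAt (𝓡 d) c).symm y :=
  (contMDiffOn_extChartAt_symm c).contMDiffAt ((isOpen_extChartAt_target c).mem_nhds hy)

theorem mdifferentiableAt_extChartAt_symm {c : M} {y : Rd d}
    (hy : y ∈ (extChartAt (𝓡 d) c).target) :
    MDifferentiableAt 𝓘(ℝ, Rd d) (𝓡 d) (extChartAt (𝓡 d) c).symm y :=
  (contMDiffAt_extChartAt_symm hy).mdifferentiableAt (by simp)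

theorem mdifferentiableAt_extChartAt_of_mem {c x : M} (hx : x ∈ (extChartAt (𝓡 d) c).source) :
    MDifferentiableAt (𝓡 d) 𝓘(ℝ, Rd d) (extChartAt (𝓡 d) c) x :=
  have := isManifold_one d M
  mdifferentiableAt_extChartAt (by simpa using hx)

theorem mfderiv_extChartAt_symm_apply {c x : M} (hx : x ∈ (extChartAt (𝓡 d) c).source)
    (v : TangentSpace (𝓡 d) x) :
    (mfderiv 𝓘(ℝ, Rd d) (𝓡 d) (extChartAt (𝓡 d) c).symm (extChartAt (𝓡 d) c x))
      (mfderiv (𝓡 d) 𝓘(ℝ, Rd d) (extChartAt (𝓡 d) c) x v) = v := by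
  have := isManifold_one d M
  have h := mfderivWithin_extChartAt_symm_comp_mfderiv_extChartAt' (I := 𝓡 d) hx
  rw [ModelWithCorners.range_eq_univ, mfderivWithin_univ] at h
  exact congrArg (fun A : TangentSpace (𝓡 d) x →L[ℝ] TangentSpace (𝓡 d) x => A v) h

theorem apply_eq_formInChart {n : ℕ} (α : ∀ x : M, TangentSpace (𝓡 d) x [⋀^Fin n]→L[ℝ] ℝ)
    {c x : M} (hx : x ∈ (extChartAt (𝓡 d) c).source) (v : Fin n → TangentSpace (𝓡 d) x) :
    α x v = formInChart α c (extChartAt (𝓡 d) c x)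
      (fun i => mfderiv (𝓡 d) 𝓘(ℝ, Rd d) (extChartAt (𝓡 d) c) x (v i)) := by
  have key : ∀ (z : M) (hz : z = x) (A : Rd d →L[ℝ] TangentSpace (𝓡 d) z)
      (B : TangentSpace (𝓡 d) x →L[ℝ] Rd d),
      (∀ w, (A (B w) : Rd d) = (w : Rd d)) → α x v = α z (fun i => A (B (v i))) := by
    rintro z rfl A B h
    congr 1
    funext i
    exact (h (v i)).symm
  refine key _ ((extChartAt (𝓡 d) c).left_inv hx) _ _ fun w => ?_
  exact mfderiv_extChartAt_symm_apply hx w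

/-- Change of charts for coordinate expressions of forms. -/
theorem formInChart_eq_pullback {n : ℕ}
    (α : ∀ x : M, TangentSpace (𝓡 d) x [⋀^Fin n]→L[ℝ] ℝ) {c c' : M} {y : Rd d}
    (hy : y ∈ (extChartAt (𝓡 d) c).target)
    (hy' : (extChartAt (𝓡 d) c).symm y ∈ (extChartAt (𝓡 d) c').source) :
    formInChart α c y =
      (formInChart α c' (extChartAt (𝓡 d) c' ((extChartAt (𝓡 d) c).symm y))
        ).compContinuousLinearMap
        (fderiv ℝ (extChartAt (𝓡 d) c' ∘ (extChartAt (𝓡 d) c).symm) y) := by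
  ext v
  have h1 : formInChart α c y v = α ((extChartAt (𝓡 d) c).symm y) fun i =>
      mfderiv 𝓘(ℝ, Rd d) (𝓡 d) (extChartAt (𝓡 d) c).symm y (v i) := rfl
  rw [h1, apply_eq_formInChart α hy', ContinuousAlternatingMap.compContinuousLinearMap_apply]
  congr 1
  funext i
  have h2 := mfderiv_comp y (mdifferentiableAt_extChartAt_of_mem hy')
    (mdifferentiableAt_extChartAt_symm hy)
  rw [← mfderiv_eq_fderiv, h2]
  rfl

theorem contDiffAt_transition {c c' : M} {y : Rd d}
    (hy : y ∈ (extChartAt (𝓡 d) c).target)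
    (hy' : (extChartAt (𝓡 d) c).symm y ∈ (extChartAt (𝓡 d) c').source) :
    ContDiffAt ℝ ∞ (extChartAt (𝓡 d) c' ∘ (extChartAt (𝓡 d) c).symm) y := by
  refine ContMDiffAt.contDiffAt ?_
  exact (contMDiffAt_extChartAt' (by simpa using hy')).comp y (contMDiffAt_extChartAt_symm hy)

theorem DiffForm.formInChart_extD {k : ℕ} (α : DiffForm d M k) (c : M) {y : Rd d}
    (hy : y ∈ (extChartAt (𝓡 d) c).target) :
    formInChart α.extD c y = extDeriv (formInChart α.toFun c) y := by
  set x := (extChartAt (𝓡 d) c).symm y with hx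
  have hxs : x ∈ (extChartAt (𝓡 d) x).source := mem_extChartAt_source x
  set T := extChartAt (𝓡 d) x ∘ (extChartAt (𝓡 d) c).symm with hT
  have hTd : ContDiffAt ℝ ∞ T y := contDiffAt_transition hy hxs
  have hω : DifferentiableAt ℝ (formInChart α.toFun x) (T y) :=
    ((α.smooth x).contDiffAt (extChartAt_target_mem_nhds x)).differentiableAt (by simp)
  have h1 : formInChart α.toFun c =ᶠ[𝓝 y] fun z =>
      (formInChart α.toFun x (T z)).compContinuousLinearMap (fderiv ℝ T z) := by
    have hs : ∀ᶠ z in 𝓝 y, (extChartAt (𝓡 d) c).symm z ∈ (extChartAt (𝓡 d) x).source :=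
      (contMDiffAt_extChartAt_symm hy).continuousAt.eventually
        ((isOpen_extChartAt_source x).mem_nhds hxs)
    filter_upwards [(isOpen_extChartAt_target c).mem_nhds hy, hs] with z hz hz'
    exact formInChart_eq_pullback α.toFun hz hz'
  rw [h1.extDeriv_eq, extDeriv_pullback hω hTd minSmoothness_two_le]
  ext v
  have h2 : fderiv ℝ T y = (mfderiv (𝓡 d) 𝓘(ℝ, Rd d) (extChartAt (𝓡 d) x) x :
      TangentSpace (𝓡 d) x →L[ℝ] Rd d).comp
      (mfderiv 𝓘(ℝ, Rd d) (𝓡 d) (extChartAt (𝓡 d) c).symm y : Rd d →L[ℝ] TangentSpace (𝓡 d) x) := by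
    rw [← mfderiv_eq_fderiv]
    exact mfderiv_comp y (mdifferentiableAt_extChartAt_of_mem hxs)
      (mdifferentiableAt_extChartAt_symm hy)
  rw [h2]
  rfl

theorem contDiffOn_extDeriv {k : ℕ} {f : Rd d → Rd d [⋀^Fin k]→L[ℝ] ℝ} {s : Set (Rd d)}
    (hs : IsOpen s) (hf : ContDiffOn ℝ ∞ f s) : ContDiffOn ℝ ∞ (extDeriv f) s :=
  (ContinuousAlternatingMap.alternatizeUncurryFinCLM ℝ (Rd d) ℝ).contDiff.comp_contDiffOn
    (hf.fderiv_of_isOpen hs (by simp))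

/-- The exterior derivative of a smooth form, as a smooth form. -/
def DiffForm.extForm {k : ℕ} (α : DiffForm d M k) : DiffForm d M (k + 1) where
  toFun := α.extD
  smooth c := (contDiffOn_extDeriv (isOpen_extChartAt_target c) (α.smooth c)).congr
    fun _ hy => α.formInChart_extD c hy

omit [IsManifold (𝓡 d) ∞ M] in
theorem DiffForm.isClosed_of_extDeriv {k : ℕ} {α : DiffForm d M k}
    (h : ∀ (c : M), extDeriv (formInChart α.toFun c) (extChartAt (𝓡 d) c c) = 0) :
    α.IsClosed := by
  intro x
  rw [DiffForm.extD, h]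
  rfl

theorem DiffForm.isClosed_extForm {k : ℕ} (α : DiffForm d M k) : α.extForm.IsClosed := by
  refine DiffForm.isClosed_of_extDeriv fun c => ?_
  have h : formInChart α.extForm.toFun c =ᶠ[𝓝 (extChartAt (𝓡 d) c c)]
      extDeriv (formInChart α.toFun c) := by
    filter_upwards [extChartAt_target_mem_nhds c] with y hy
    exact α.formInChart_extD c hy
  rw [h.extDeriv_eq]
  exact extDeriv_extDeriv_apply ((α.smooth c).contDiffAt (extChartAt_target_mem_nhds c))
    minSmoothness_two_le

theorem formInChart_pullback {k : ℕ} {h : M → Rd d} (hh : ContMDiff (𝓡 d) 𝓘(ℝ, Rd d) ∞ h)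
    (β : Rd d [⋀^Fin k]→L[ℝ] ℝ) (c : M) {y : Rd d} (hy : y ∈ (extChartAt (𝓡 d) c).target) :
    formInChart (fun x => β.compContinuousLinearMap
        (mfderiv (𝓡 d) 𝓘(ℝ, Rd d) h x : TangentSpace (𝓡 d) x →L[ℝ] Rd d)) c y =
      β.compContinuousLinearMap (fderiv ℝ (h ∘ (extChartAt (𝓡 d) c).symm) y) := by
  ext v
  have h2 := mfderiv_comp y ((hh _).mdifferentiableAt (by simp))
    (mdifferentiableAt_extChartAt_symm hy)
  rw [← mfderiv_eq_fderiv, h2]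
  rfl

theorem contDiffOn_comp_extChartAt_symm {h : M → Rd d}
    (hh : ContMDiff (𝓡 d) 𝓘(ℝ, Rd d) ∞ h) (c : M) :
    ContDiffOn ℝ ∞ (h ∘ (extChartAt (𝓡 d) c).symm) (extChartAt (𝓡 d) c).target := by
  refine ContMDiffOn.contDiffOn ?_
  exact hh.comp_contMDiffOn (contMDiffOn_extChartAt_symm c)

/-- The pullback of a constant form on `ℝᵈ` by a smooth map `M → ℝᵈ`. -/
def pullbackForm {k : ℕ} (h : M → Rd d) (hh : ContMDiff (𝓡 d) 𝓘(ℝ, Rd d) ∞ h)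
    (β : Rd d [⋀^Fin k]→L[ℝ] ℝ) : DiffForm d M k where
  toFun x := β.compContinuousLinearMap
    (mfderiv (𝓡 d) 𝓘(ℝ, Rd d) h x : TangentSpace (𝓡 d) x →L[ℝ] Rd d)
  smooth c := (contDiffOn_compContinuousLinearMap β
    ((contDiffOn_comp_extChartAt_symm hh c).fderiv_of_isOpen (isOpen_extChartAt_target c)
      (by simp))).congr fun _ hy => formInChart_pullback hh β c hy

theorem isClosed_pullbackForm {k : ℕ} {h : M → Rd d} (hh : ContMDiff (𝓡 d) 𝓘(ℝ, Rd d) ∞ h)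
    (β : Rd d [⋀^Fin k]→L[ℝ] ℝ) : (pullbackForm h hh β).IsClosed := by
  refine DiffForm.isClosed_of_extDeriv fun c => ?_
  have h1 : formInChart (pullbackForm h hh β).toFun c =ᶠ[𝓝 (extChartAt (𝓡 d) c c)]
      fun y => ((fun _ : Rd d => β) ((h ∘ (extChartAt (𝓡 d) c).symm) y)).compContinuousLinearMap
        (fderiv ℝ (h ∘ (extChartAt (𝓡 d) c).symm) y) := by
    filter_upwards [extChartAt_target_mem_nhds c] with y hy
    exact formInChart_pullback hh β c hy
  have hβ : DifferentiableAt ℝ (fun _ : Rd d => β)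
      ((h ∘ (extChartAt (𝓡 d) c).symm) (extChartAt (𝓡 d) c c)) := differentiableAt_const β
  have h2 := extDeriv_pullback hβ
    ((contDiffOn_comp_extChartAt_symm hh c).contDiffAt (extChartAt_target_mem_nhds c))
    minSmoothness_two_le
  have h3 : extDeriv (fun _ : Rd d => β)
      ((h ∘ (extChartAt (𝓡 d) c).symm) (extChartAt (𝓡 d) c c)) = 0 := by
    rw [extDeriv]
    simpa using map_zero (ContinuousAlternatingMap.alternatizeUncurryFinCLM ℝ (Rd d) ℝ)
  rw [h1.extDeriv_eq, h2, h3]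
  rfl

end ManifoldForms

section TnBundle

variable {d n : ℕ} {M : Type*} [TopologicalSpace M] [ChartedSpace (Rd d) M]
  [IsManifold (𝓡 d) ∞ M]

/-- The trivialization of `TⁿM` at `c`. -/
abbrev tnTriv (n : ℕ) (c : M) :
    Trivialization (Fin n → Rd d) (π (Fin n → Rd d) (fun x : M => TnSpace d n x)) :=
  trivializationAt (Fin n → Rd d) (fun x : M => TnSpace d n x) c

theorem tnTriv_baseSet (c : M) : (tnTriv (d := d) n c).baseSet = (extChartAt (𝓡 d) c).source := by
  rw [extChartAt_source]
  rfl

theorem mem_tnTriv_baseSet {c x : M} :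
    x ∈ (tnTriv (d := d) n c).baseSet ↔ x ∈ (extChartAt (𝓡 d) c).source := by
  rw [tnTriv_baseSet]

theorem tnTriv_apply (c : M) (p : TnM d n M) (hp : p.proj ∈ (extChartAt (𝓡 d) c).source)
    (i : Fin n) :
    (tnTriv n c p).2 i = mfderiv (𝓡 d) 𝓘(ℝ, Rd d) (extChartAt (𝓡 d) c) p.proj (p.snd i) := by
  have := isManifold_one d M
  have hs : p.proj ∈ (chartAt (Rd d) c).source := by simpa using hp
  have h1 := TangentBundle.continuousLinearMapAt_trivializationAt (I := 𝓡 d) hs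
  rw [TangentBundle.continuousLinearMapAt_trivializationAt_eq_core hs] at h1
  exact congrArg (fun A : Rd d →L[ℝ] Rd d => A (p.snd i)) h1

theorem tangentTriv_apply (c x : M) (hx : x ∈ (extChartAt (𝓡 d) c).source)
    (u : TangentSpace (𝓡 d) x) :
    (trivializationAt (Rd d) (TangentSpace (𝓡 d)) c ⟨x, u⟩).2 =
      mfderiv (𝓡 d) 𝓘(ℝ, Rd d) (extChartAt (𝓡 d) c) x u := by
  have := isManifold_one d M
  have hs : x ∈ (chartAt (Rd d) c).source := by simpa using hx
  have h1 := TangentBundle.continuousLinearMapAt_trivializationAt (I := 𝓡 d) hs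
  rw [TangentBundle.continuousLinearMapAt_trivializationAt_eq_core hs] at h1
  exact congrArg (fun A : Rd d →L[ℝ] Rd d => A u) h1

/-- Smoothness of maps into `TⁿM` in terms of preferred charts of `M`. -/
theorem contMDiffAt_tnM {E H P : Type*} [NormedAddCommGroup E] [NormedSpace ℝ E]
    [TopologicalSpace H] {I : ModelWithCorners ℝ E H} [TopologicalSpace P] [ChartedSpace H P]
    {f : P → TnM d n M} {q : P} (h1 : ContMDiffAt I (𝓡 d) ∞ (fun z => (f z).proj) q)
    (h2 : ∀ i, ContMDiffAt I 𝓘(ℝ, Rd d) ∞ (fun z => (tnTriv n (f q).proj (f z)).2 i) q) :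
    ContMDiffAt I (tnModel d n) ∞ f q := by
  rw [contMDiffAt_totalSpace]
  exact ⟨h1, contMDiffAt_pi_space.2 h2⟩

theorem contMDiffAt_tnTriv (c : M) (p : TnM d n M) (hp : p.proj ∈ (extChartAt (𝓡 d) c).source)
    (i : Fin n) :
    ContMDiffAt (tnModel d n) 𝓘(ℝ, Rd d) ∞ (fun q : TnM d n M => (tnTriv n c q).2 i) p := by
  have h := (tnTriv (d := d) n c).contMDiffOn (IB := 𝓡 d) (n := ∞)
  have h' := h.contMDiffAt ((tnTriv (d := d) n c).open_source.mem_nhds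
    ((tnTriv (d := d) n c).mem_source.2 (mem_tnTriv_baseSet.2 hp)))
  exact contMDiffAt_pi_space.1 h'.snd i

theorem contMDiff_tnProj : ContMDiff (tnModel d n) (𝓡 d) ∞ (fun p : TnM d n M => p.proj) :=
  contMDiff_proj (fun x : M => TnSpace d n x)

theorem continuous_tnProj : Continuous (fun p : TnM d n M => p.proj) :=
  contMDiff_tnProj.continuous

theorem continuous_formFun (α : DiffForm d M n) :
    Continuous (formFun α.toFun : TnM d n M → ℝ) := by
  rw [continuous_iff_continuousAt]
  intro p
  set c := p.proj
  have hs : ∀ᶠ q : TnM d n M in 𝓝 p, q.proj ∈ (extChartAt (𝓡 d) c).source :=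
    continuous_tnProj.continuousAt.eventually (extChartAt_source_mem_nhds c)
  have h1 : (formFun α.toFun : TnM d n M → ℝ) =ᶠ[𝓝 p] fun q =>
      formInChart α.toFun c (extChartAt (𝓡 d) c q.proj) (tnTriv n c q).2 := by
    filter_upwards [hs] with q hq
    refine (apply_eq_formInChart α.toFun hq q.snd).trans ?_
    congr 1
    funext i
    exact (tnTriv_apply c q hq i).symm
  refine ContinuousAt.congr ?_ h1.symm
  have hA : ContinuousAt (fun q : TnM d n M => formInChart α.toFun c
      (extChartAt (𝓡 d) c q.proj)) p := by
    have h2 : ContinuousAt (formInChart α.toFun c) (extChartAt (𝓡 d) c c) :=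
      ((α.smooth c).contDiffAt (extChartAt_target_mem_nhds c)).continuousAt
    exact ContinuousAt.comp (f := fun q : TnM d n M => extChartAt (𝓡 d) c q.proj) h2
      (ContinuousAt.comp (f := fun q : TnM d n M => q.proj) (continuousAt_extChartAt c)
        continuous_tnProj.continuousAt)
  have hB : ContinuousAt (fun q : TnM d n M => (tnTriv n c q).2) p :=
    continuousAt_pi.2 fun i => (contMDiffAt_tnTriv c p (mem_extChartAt_source c) i).continuousAt
  exact hA.eval hB

/-- A smooth vector field. -/
def IsSmoothField (Z : ∀ x : M, TangentSpace (𝓡 d) x) : Prop :=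
  ContMDiff (𝓡 d) (𝓡 d).tangent ∞ (fun x => (⟨x, Z x⟩ : TangentBundle (𝓡 d) M))

theorem IsSmoothField.contMDiffAt {Z : ∀ x : M, TangentSpace (𝓡 d) x} (hZ : IsSmoothField (d := d) Z)
    (c : M) : ContMDiffAt (𝓡 d) 𝓘(ℝ, Rd d) ∞
      (fun x => mfderiv (𝓡 d) 𝓘(ℝ, Rd d) (extChartAt (𝓡 d) c) x (Z x)) c := by
  have h := (contMDiffAt_totalSpace.1 (hZ c)).2
  refine h.congr_of_eventuallyEq ?_
  filter_upwards [extChartAt_source_mem_nhds (I := 𝓡 d) c] with x hx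
  exact (tangentTriv_apply c x hx (Z x)).symm

/-- The section of `TⁿM` given by `n` vector fields. -/
def tnSection (W : Fin n → ∀ x : M, TangentSpace (𝓡 d) x) (x : M) : TnM d n M :=
  ⟨x, fun i => W i x⟩

theorem continuous_tnSection {W : Fin n → ∀ x : M, TangentSpace (𝓡 d) x}
    (hW : ∀ i, IsSmoothField (d := d) (W i)) : Continuous (tnSection W) := by
  have : ContMDiff (𝓡 d) (tnModel d n) ∞ (tnSection W) := by
    intro c
    refine contMDiffAt_tnM contMDiffAt_id fun i => ?_
    refine ((hW i).contMDiffAt c).congr_of_eventuallyEq ?_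
    filter_upwards [extChartAt_source_mem_nhds (I := 𝓡 d) c] with x hx
    exact tnTriv_apply c (tnSection W x) hx i
  exact this.continuous

/-- Replace `vᵢ` by `a vᵢ + r Z(x)`. -/
def slotMap (i : Fin n) (Z : ∀ x : M, TangentSpace (𝓡 d) x) (p : TnM d n M) (a r : ℝ) :
    TnM d n M :=
  ⟨p.proj, Function.update (β := fun _ => TangentSpace (𝓡 d) p.proj) p.snd i
    (a • (p.snd i : TangentSpace (𝓡 d) p.proj) + r • Z p.proj)⟩

omit [IsManifold (𝓡 d) ∞ M] in
theorem slotMap_one_zero (i : Fin n) (Z : ∀ x : M, TangentSpace (𝓡 d) x) (p : TnM d n M) :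
    slotMap i Z p 1 0 = p := by
  have : Function.update (β := fun _ => TangentSpace (𝓡 d) p.proj) p.snd i
      ((1 : ℝ) • (p.snd i : TangentSpace (𝓡 d) p.proj) + (0 : ℝ) • Z p.proj) = p.snd := by
    rw [one_smul, zero_smul, add_zero]
    exact Function.update_eq_self (β := fun _ => TangentSpace (𝓡 d) p.proj) i p.snd
  exact congrArg (fun w => (⟨p.proj, w⟩ : TnM d n M)) this

theorem contMDiff_slotMap (i : Fin n) {Z : ∀ x : M, TangentSpace (𝓡 d) x} (hZ : IsSmoothField (d := d) Z) :
    ContMDiff ((tnModel d n).prod 𝓘(ℝ, ℝ × ℝ)) (tnModel d n) ∞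
      (fun q : TnM d n M × (ℝ × ℝ) => slotMap i Z q.1 q.2.1 q.2.2) := by
  intro q
  set c := q.1.proj with hc
  have hproj : ContMDiffAt ((tnModel d n).prod 𝓘(ℝ, ℝ × ℝ)) (𝓡 d) ∞
      (fun z : TnM d n M × (ℝ × ℝ) => z.1.proj) q :=
    (contMDiff_tnProj _).comp q contMDiffAt_fst
  refine contMDiffAt_tnM hproj fun j => ?_
  have hs : ∀ᶠ z : TnM d n M × (ℝ × ℝ) in 𝓝 q, z.1.proj ∈ (extChartAt (𝓡 d) c).source :=
    hproj.continuousAt.eventually (extChartAt_source_mem_nhds c)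
  have hcomp : ∀ j, ContMDiffAt ((tnModel d n).prod 𝓘(ℝ, ℝ × ℝ)) 𝓘(ℝ, Rd d) ∞
      (fun z : TnM d n M × (ℝ × ℝ) => (tnTriv n c z.1).2 j) q := fun j =>
    ContMDiffAt.comp (g := fun p : TnM d n M => (tnTriv n c p).2 j) q
      (contMDiffAt_tnTriv c q.1 (mem_extChartAt_source c) j) contMDiffAt_fst
  by_cases hj : j = i
  · subst hj
    have ha : ContMDiffAt ((tnModel d n).prod 𝓘(ℝ, ℝ × ℝ)) 𝓘(ℝ, ℝ) ∞
        (fun z : TnM d n M × (ℝ × ℝ) => z.2.1) q :=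
      ContMDiffAt.comp (I' := 𝓘(ℝ, ℝ × ℝ)) (g := fun z : ℝ × ℝ => z.1) q
        contDiffAt_fst.contMDiffAt contMDiffAt_snd
    have hr : ContMDiffAt ((tnModel d n).prod 𝓘(ℝ, ℝ × ℝ)) 𝓘(ℝ, ℝ) ∞
        (fun z : TnM d n M × (ℝ × ℝ) => z.2.2) q :=
      ContMDiffAt.comp (I' := 𝓘(ℝ, ℝ × ℝ)) (g := fun z : ℝ × ℝ => z.2) q
        contDiffAt_snd.contMDiffAt contMDiffAt_snd
    have hz : ContMDiffAt ((tnModel d n).prod 𝓘(ℝ, ℝ × ℝ)) 𝓘(ℝ, Rd d) ∞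
        (fun z : TnM d n M × (ℝ × ℝ) =>
          mfderiv (𝓡 d) 𝓘(ℝ, Rd d) (extChartAt (𝓡 d) c) z.1.proj (Z z.1.proj)) q :=
      ContMDiffAt.comp (g := fun x : M => mfderiv (𝓡 d) 𝓘(ℝ, Rd d) (extChartAt (𝓡 d) c) x (Z x)) q
        (hZ.contMDiffAt c) hproj
    refine ((ha.smul (hcomp j)).add (hr.smul hz)).congr_of_eventuallyEq ?_
    filter_upwards [hs] with z hz
    refine (tnTriv_apply c (slotMap j Z z.1 z.2.1 z.2.2) hz j).trans ?_
    have h1 : (slotMap j Z z.1 z.2.1 z.2.2).snd j =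
        (z.2.1 • (z.1.snd j : TangentSpace (𝓡 d) z.1.proj) + z.2.2 • Z z.1.proj) :=
      Function.update_self (β := fun _ => TangentSpace (𝓡 d) z.1.proj) j _ z.1.snd
    rw [h1]
    change mfderiv (𝓡 d) 𝓘(ℝ, Rd d) (extChartAt (𝓡 d) c) z.1.proj
      (z.2.1 • (z.1.snd j : TangentSpace (𝓡 d) z.1.proj) + z.2.2 • Z z.1.proj) = _
    rw [map_add, map_smul, map_smul]
    simp only [Pi.add_apply]
    congr 2
    exact (tnTriv_apply c z.1 hz j).symm
  · refine (hcomp j).congr_of_eventuallyEq ?_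
    filter_upwards [hs] with z hz
    refine (tnTriv_apply c (slotMap i Z z.1 z.2.1 z.2.2) hz j).trans ?_
    refine Eq.trans ?_ (tnTriv_apply c z.1 hz j).symm
    have h1 : (slotMap i Z z.1 z.2.1 z.2.2).snd j = z.1.snd j :=
      Function.update_of_ne (β := fun _ => TangentSpace (𝓡 d) z.1.proj) hj _ z.1.snd
    rw [h1]
    rfl

end TnBundle

section TnTopology

variable {d n : ℕ} {M : Type*} [TopologicalSpace M] [ChartedSpace (Rd d) M]
  [IsManifold (𝓡 d) ∞ M]

theorem t2Space_tnM (d n : ℕ) (M : Type*) [TopologicalSpace M] [ChartedSpace (Rd d) M]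
    [IsManifold (𝓡 d) ∞ M] [T2Space M] : T2Space (TnM d n M) := by
  refine ⟨fun p q hpq => ?_⟩
  by_cases h : p.proj = q.proj
  · set e := tnTriv (d := d) n p.proj
    have hp : p ∈ e.source := e.mem_source.2 (mem_baseSet_trivializationAt _ _ _)
    have hq : q ∈ e.source := e.mem_source.2 (h ▸ mem_baseSet_trivializationAt _ _ _)
    have hne : e p ≠ e q := fun h' => hpq (e.injOn hp hq h')
    obtain ⟨u, v, hu, hv, hpu, hqv, huv⟩ := t2_separation hne
    refine ⟨e.source ∩ e ⁻¹' u, e.source ∩ e ⁻¹' v,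
      e.continuousOn.isOpen_inter_preimage e.open_source hu,
      e.continuousOn.isOpen_inter_preimage e.open_source hv, ⟨hp, hpu⟩, ⟨hq, hqv⟩, ?_⟩
    exact (huv.preimage e).mono inter_subset_right inter_subset_right
  · exact separated_by_continuous continuous_tnProj h

theorem sigmaCompactSpace_tnM (d n : ℕ) (M : Type*) [TopologicalSpace M] [ChartedSpace (Rd d) M]
    [IsManifold (𝓡 d) ∞ M] [CompactSpace M] : SigmaCompactSpace (TnM d n M) := by
  have : LocallyCompactSpace M := ChartedSpace.locallyCompactSpace (Rd d) M
  have h : ∀ x : M, ∃ K : Set M, IsCompact K ∧ K ∈ 𝓝 x ∧ K ⊆ (tnTriv (d := d) n x).baseSet := by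
    intro x
    obtain ⟨K, hK, hKs, hKc⟩ := local_compact_nhds
      ((tnTriv (d := d) n x).open_baseSet.mem_nhds (mem_baseSet_trivializationAt _ _ x))
    exact ⟨K, hKc, hK, hKs⟩
  choose K hKc hKn hKs using h
  obtain ⟨t, ht⟩ := CompactSpace.elim_nhds_subcover K hKn
  rw [← isSigmaCompact_univ_iff]
  have hcov : (univ : Set (TnM d n M)) =
      ⋃ x : t, ⋃ r : ℕ, (tnTriv (d := d) n x.1).toOpenPartialHomeomorph.symm ''
        (K x.1 ×ˢ Metric.closedBall 0 r) := by
    refine (eq_univ_of_forall fun p => ?_).symm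
    have hp : p.proj ∈ ⋃ x ∈ t, K x := by
      rw [ht]
      trivial
    simp only [mem_iUnion] at hp
    obtain ⟨x, hx, hpx⟩ := hp
    obtain ⟨r, hr⟩ := exists_nat_ge ‖(tnTriv n x p).2‖
    simp only [mem_iUnion]
    have hps : p ∈ (tnTriv (d := d) n x).source := (tnTriv n x).mem_source.2 (hKs x hpx)
    refine ⟨⟨x, hx⟩, r, tnTriv n x p, ⟨?_, ?_⟩, ?_⟩
    · rw [(tnTriv n x).coe_fst hps]
      exact hpx
    · simpa using hr
    · exact (tnTriv (d := d) n x).toOpenPartialHomeomorph.left_inv hps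
  rw [hcov]
  refine isSigmaCompact_iUnion _ fun x => isSigmaCompact_iUnion _ fun r => ?_
  refine IsCompact.isSigmaCompact ?_
  refine ((hKc x.1).prod (isCompact_closedBall _ _)).image_of_continuousOn ?_
  refine (tnTriv (d := d) n x.1).toOpenPartialHomeomorph.continuousOn_symm.mono ?_
  rintro ⟨y, w⟩ ⟨hy, -⟩
  exact (tnTriv (d := d) n x.1).mem_target.2 (hKs _ hy)

theorem locallyCompactSpace_tnM (d n : ℕ) (M : Type*) [TopologicalSpace M] [ChartedSpace (Rd d) M]
    [IsManifold (𝓡 d) ∞ M] : LocallyCompactSpace (TnM d n M) :=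
  Manifold.locallyCompact_of_finiteDimensional (tnModel d n)

theorem regular_of_isFiniteMeasure_tnM [T2Space M] [CompactSpace M] (μ : Measure (TnM d n M))
    [IsFiniteMeasure μ] : μ.Regular := by
  have := t2Space_tnM d n M
  have := sigmaCompactSpace_tnM d n M
  have := Manifold.metrizableSpace (tnModel d n) (TnM d n M)
  have := locallyCompactSpace_tnM d n M
  infer_instance

end TnTopology

section VerticalDerivative

variable {d n : ℕ} {M : Type*} [TopologicalSpace M] [ChartedSpace (Rd d) M]
  [IsManifold (𝓡 d) ∞ M]

theorem continuous_slotMap (i : Fin n) {Z : ∀ x : M, TangentSpace (𝓡 d) x}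
    (hZ : IsSmoothField (d := d) Z) :
    Continuous (fun q : TnM d n M × (ℝ × ℝ) => slotMap i Z q.1 q.2.1 q.2.2) :=
  (contMDiff_slotMap i hZ).continuous

theorem contMDiff_comp_slotMap_one (i : Fin n) {Z : ∀ x : M, TangentSpace (𝓡 d) x}
    (hZ : IsSmoothField (d := d) Z) {f : TnM d n M → ℝ}
    (hf : ContMDiff (tnModel d n) 𝓘(ℝ, ℝ) ∞ f) :
    ContMDiff ((tnModel d n).prod 𝓘(ℝ, ℝ)) 𝓘(ℝ, ℝ) ∞
      (Function.uncurry fun (p : TnM d n M) (r : ℝ) => f (slotMap i Z p 1 r)) := by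
  have h : ContMDiff ((tnModel d n).prod 𝓘(ℝ, ℝ)) ((tnModel d n).prod 𝓘(ℝ, ℝ × ℝ)) ∞
      (fun q : TnM d n M × ℝ => (q.1, ((1 : ℝ), q.2))) :=
    contMDiff_fst.prodMk (ContMDiff.comp (I' := 𝓘(ℝ, ℝ)) (g := fun r : ℝ => ((1 : ℝ), r))
      (contDiff_const.prodMk contDiff_id).contMDiff contMDiff_snd)
  exact hf.comp ((contMDiff_slotMap i hZ).comp h)

/-- The derivative of `f` in the variable `vᵢ` in direction of `Z`, at `vᵢ + r Z`. -/
def slotDeriv (i : Fin n) (Z : ∀ x : M, TangentSpace (𝓡 d) x) (f : TnM d n M → ℝ)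
    (p : TnM d n M) (r : ℝ) : ℝ :=
  deriv (fun s => f (slotMap i Z p 1 s)) r

theorem hasDerivAt_slotMap (i : Fin n) {Z : ∀ x : M, TangentSpace (𝓡 d) x}
    (hZ : IsSmoothField (d := d) Z) {f : TnM d n M → ℝ}
    (hf : ContMDiff (tnModel d n) 𝓘(ℝ, ℝ) ∞ f) (p : TnM d n M) (r : ℝ) :
    HasDerivAt (fun s => f (slotMap i Z p 1 s)) (slotDeriv i Z f p r) r := by
  have h : ContMDiff 𝓘(ℝ, ℝ) 𝓘(ℝ, ℝ) ∞ (fun s => f (slotMap i Z p 1 s)) :=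
    (contMDiff_comp_slotMap_one i hZ hf).comp (contMDiff_const.prodMk contMDiff_id)
  exact (h.contDiff.differentiable (by simp) r).hasDerivAt

theorem continuous_slotDeriv (i : Fin n) {Z : ∀ x : M, TangentSpace (𝓡 d) x}
    (hZ : IsSmoothField (d := d) Z) {f : TnM d n M → ℝ}
    (hf : ContMDiff (tnModel d n) 𝓘(ℝ, ℝ) ∞ f) :
    Continuous (fun q : TnM d n M × ℝ => slotDeriv i Z f q.1 q.2) := by
  rw [continuous_iff_continuousAt]
  intro q
  have h := ContMDiffAt.mfderiv (I := 𝓘(ℝ, ℝ)) (I' := 𝓘(ℝ, ℝ)) (J := (tnModel d n).prod 𝓘(ℝ, ℝ))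
    (m := 0) (n := ∞) (x₀ := q)
    (fun (q : TnM d n M × ℝ) (r : ℝ) => f (slotMap i Z q.1 1 r)) (fun q => q.2)
    (((contMDiff_comp_slotMap_one i hZ hf).comp
      ((contMDiff_fst.comp contMDiff_fst).prodMk contMDiff_snd)) (q, q.2))
    contMDiffAt_snd (by simp)
  have h2 := h.continuousAt.clm_apply (continuousAt_const (y := (1 : ℝ)))
  refine h2.congr ?_
  filter_upwards with z
  have h3 := inTangentCoordinates_model_space (I := 𝓘(ℝ, ℝ)) (I' := 𝓘(ℝ, ℝ))
    (fun q : TnM d n M × ℝ => q.2) (fun q => f (slotMap i Z q.1 1 q.2))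
    (fun q => mfderiv 𝓘(ℝ, ℝ) 𝓘(ℝ, ℝ) (fun r => f (slotMap i Z q.1 1 r)) q.2) q
  refine (congrArg (fun A : ℝ →L[ℝ] ℝ => A 1) (congrFun h3 z)).trans ?_
  exact congrArg (fun A : ℝ →L[ℝ] ℝ => A 1)
    (mfderiv_eq_fderiv (f := fun r => f (slotMap i Z z.1 1 r)) (x := z.2))

theorem continuous_slotDeriv_zero (i : Fin n) {Z : ∀ x : M, TangentSpace (𝓡 d) x}
    (hZ : IsSmoothField (d := d) Z) {f : TnM d n M → ℝ}
    (hf : ContMDiff (tnModel d n) 𝓘(ℝ, ℝ) ∞ f) :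
    Continuous (fun p : TnM d n M => slotDeriv i Z f p 0) :=
  (continuous_slotDeriv i hZ hf).comp (continuous_id.prodMk continuous_const)

omit [IsManifold (𝓡 d) ∞ M] in
theorem formFun_slotMap (i : Fin n) (Z : ∀ x : M, TangentSpace (𝓡 d) x)
    (α : ∀ x : M, TangentSpace (𝓡 d) x [⋀^Fin n]→L[ℝ] ℝ) (p : TnM d n M) (a r : ℝ) :
    formFun α (slotMap i Z p a r) =
      a * formFun α p + r * α p.proj (Function.update p.snd i (Z p.proj)) := by
  have h : formFun α (slotMap i Z p a r) = α p.proj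
      (Function.update (β := fun _ => TangentSpace (𝓡 d) p.proj) p.snd i
        (a • (p.snd i : TangentSpace (𝓡 d) p.proj) + r • Z p.proj)) := rfl
  have h2 := (α p.proj).map_update_add (p.snd : Fin n → TangentSpace (𝓡 d) p.proj) i
    (a • (p.snd i : TangentSpace (𝓡 d) p.proj)) (r • Z p.proj)
  have h3 := (α p.proj).map_update_smul (p.snd : Fin n → TangentSpace (𝓡 d) p.proj) i a (p.snd i)
  have h4 := (α p.proj).map_update_smul (p.snd : Fin n → TangentSpace (𝓡 d) p.proj) i r (Z p.proj)
  have h5 := Function.update_eq_self (β := fun _ => TangentSpace (𝓡 d) p.proj) i p.snd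
  rw [h, h2, h3, h4, h5]
  rfl

omit [IsManifold (𝓡 d) ∞ M] in
theorem slotDeriv_formFun (i : Fin n) (Z : ∀ x : M, TangentSpace (𝓡 d) x)
    (α : ∀ x : M, TangentSpace (𝓡 d) x [⋀^Fin n]→L[ℝ] ℝ) (p : TnM d n M) (r : ℝ) :
    slotDeriv i Z (formFun α) p r = α p.proj (Function.update p.snd i (Z p.proj)) := by
  have h : (fun s => formFun α (slotMap i Z p 1 s)) =
      fun s => 1 * formFun α p + s * α p.proj (Function.update p.snd i (Z p.proj)) := by
    funext s
    exact formFun_slotMap i Z α p 1 s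
  rw [slotDeriv, h]
  simp

end VerticalDerivative

section ChartDeriv

variable {d n : ℕ} {M : Type*} [TopologicalSpace M] [ChartedSpace (Rd d) M]
  [IsManifold (𝓡 d) ∞ M]

omit [IsManifold (𝓡 d) ∞ M] in
variable (d) in
/-- The derivative at `x` of the preferred chart at `c`. -/
def chartDeriv (c x : M) : TangentSpace (𝓡 d) x →L[ℝ] Rd d :=
  mfderiv (𝓡 d) 𝓘(ℝ, Rd d) (extChartAt (𝓡 d) c) x

theorem chartDeriv_injective {c x : M} (hx : x ∈ (extChartAt (𝓡 d) c).source)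
    {u w : TangentSpace (𝓡 d) x} (h : chartDeriv d c x u = chartDeriv d c x w) : u = w := by
  rw [← mfderiv_extChartAt_symm_apply hx u, ← mfderiv_extChartAt_symm_apply hx w]
  exact congrArg (fun z : Rd d => (mfderiv 𝓘(ℝ, Rd d) (𝓡 d) (extChartAt (𝓡 d) c).symm
    (extChartAt (𝓡 d) c x) : Rd d →L[ℝ] TangentSpace (𝓡 d) _) z) h

/-- Smooth vector fields that form a frame near `c`, dual to the chart. -/
theorem exists_local_fields [T2Space M] (c : M) :
    ∃ Z : Fin d → ∀ x : M, TangentSpace (𝓡 d) x, (∀ a, IsSmoothField (d := d) (Z a)) ∧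
      ∀ᶠ x in 𝓝 c, ∀ a, chartDeriv d c x (Z a x) = EuclideanSpace.basisFun (Fin d) ℝ a := by
  have := isManifold_one d M
  let b := (EuclideanSpace.basisFun (Fin d) ℝ).toBasis
  let e := trivializationAt (Rd d) (TangentSpace (𝓡 d) : M → Type _) c
  let ρ : SmoothBumpFunction (𝓡 d) c := Classical.arbitrary _
  refine ⟨fun a => (ρ : M → ℝ) • e.localFrame b a, fun a => ?_, ?_⟩
  · refine ContMDiffOn.smul_section_of_tsupport (u := (chartAt (Rd d) c).source)
      ρ.contMDiff.contMDiffOn (chartAt (Rd d) c).open_source ρ.tsupport_subset_chartAt_source ?_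
    exact e.contMDiffOn_localFrame_baseSet ∞ b a
  · filter_upwards [ρ.eventuallyEq_one, extChartAt_source_mem_nhds (I := 𝓡 d) c] with x hx hxs a
    have hb : x ∈ e.baseSet := by simpa [e] using hxs
    have h1 : ((ρ : M → ℝ) • e.localFrame b a) x = e.basisAt b hb a := by
      rw [Pi.smul_apply', hx, e.localFrame_apply_of_mem_baseSet b hb]
      exact one_smul ℝ _
    rw [h1]
    have h2 := tangentTriv_apply c x hxs (e.basisAt b hb a)
    refine h2.symm.trans ?_
    have h3 : (e.linearEquivAt ℝ x hb) (e.basisAt b hb a) = b a :=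
      LinearEquiv.apply_symm_apply (e.linearEquivAt ℝ x hb) (b a)
    refine Eq.trans ?_ (h3.trans ?_)
    · rfl
    · simp [b]

theorem exists_local_function [T2Space M] (c : M) :
    ∃ h : M → Rd d, ContMDiff (𝓡 d) 𝓘(ℝ, Rd d) ∞ h ∧
      ∀ᶠ x in 𝓝 c, (mfderiv (𝓡 d) 𝓘(ℝ, Rd d) h x : TangentSpace (𝓡 d) x →L[ℝ] Rd d) =
        chartDeriv d c x := by
  let ρ : SmoothBumpFunction (𝓡 d) c := Classical.arbitrary _
  refine ⟨fun x => ρ x • extChartAt (𝓡 d) c x, ρ.contMDiff_smul contMDiffOn_extChartAt, ?_⟩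
  have h : (fun x => ρ x • extChartAt (𝓡 d) c x) =ᶠ[𝓝 c] extChartAt (𝓡 d) c := by
    filter_upwards [ρ.eventuallyEq_one] with x hx
    rw [hx, Pi.one_apply, one_smul]
  filter_upwards [h.eventually_nhds] with x hx
  exact Filter.EventuallyEq.mfderiv_eq hx

/-- Near `c`, alternating forms have an expansion with closed coefficient forms. -/
theorem exists_local_expansion [T2Space M] (n : ℕ) (c : M) :
    ∃ (Z : Fin d → ∀ x : M, TangentSpace (𝓡 d) x) (A : (Fin n → Fin d) → DiffForm d M n),
      (∀ a, IsSmoothField (d := d) (Z a)) ∧ (∀ J, (A J).IsClosed) ∧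
      ∀ᶠ x in 𝓝 c, x ∈ (extChartAt (𝓡 d) c).source ∧
        (∀ a, chartDeriv d c x (Z a x) = EuclideanSpace.basisFun (Fin d) ℝ a) ∧
        ∀ (α : ∀ x : M, TangentSpace (𝓡 d) x [⋀^Fin n]→L[ℝ] ℝ) (v : Fin n → TangentSpace (𝓡 d) x),
          α x v = ∑ J, (A J).toFun x v * α x fun i => Z (J i) x := by
  obtain ⟨Z, hZ, hZc⟩ := exists_local_fields (d := d) c
  obtain ⟨h, hh, hhc⟩ := exists_local_function (d := d) c
  obtain ⟨β, hβ⟩ := exists_alternating_expansion d n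
  refine ⟨Z, fun J => pullbackForm h hh (β J), hZ, fun J => isClosed_pullbackForm hh (β J), ?_⟩
  filter_upwards [hZc, hhc, extChartAt_source_mem_nhds (I := 𝓡 d) c] with x hx hx' hxs
  refine ⟨hxs, hx, fun α v => ?_⟩
  have h1 : ∀ w : Fin n → TangentSpace (𝓡 d) x, α x w =
      formInChart α c (extChartAt (𝓡 d) c x) fun i => chartDeriv d c x (w i) :=
    fun w => apply_eq_formInChart α hxs w
  rw [h1, hβ]
  refine Finset.sum_congr rfl fun J _ => ?_
  rw [h1]
  have h2 : (pullbackForm h hh (β J)).toFun x v =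
      β J fun i => (mfderiv (𝓡 d) 𝓘(ℝ, Rd d) h x : TangentSpace (𝓡 d) x →L[ℝ] Rd d) (v i) := rfl
  rw [h2, hx']
  congr 2
  funext i
  exact (hx (J i)).symm

variable [RiemannianBundle (fun x : M => TangentSpace (𝓡 d) x)]

theorem isContinuousRiemannianBundle_tangent
    [h : IsContMDiffRiemannianBundle (𝓡 d) ∞ (Rd d) (fun x : M => TangentSpace (𝓡 d) x)] :
    IsContinuousRiemannianBundle (Rd d) (fun x : M => TangentSpace (𝓡 d) x) := by
  obtain ⟨g, hg, hg'⟩ := h.exists_contMDiff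
  exact ⟨g, hg.continuous, hg'⟩

theorem eventually_norm_chartDeriv_le [IsContMDiffRiemannianBundle (𝓡 d) ∞ (Rd d)
    (fun x : M => TangentSpace (𝓡 d) x)] (c : M) :
    ∃ C : ℝ, 0 < C ∧ ∀ᶠ x in 𝓝 c, ∀ u : TangentSpace (𝓡 d) x, ‖chartDeriv d c x u‖ ≤ C * ‖u‖ := by
  have := isManifold_one d M
  have := isContinuousRiemannianBundle_tangent (d := d) (M := M)
  obtain ⟨C, hC, h⟩ := eventually_norm_trivializationAt_lt (Rd d)
    (fun x : M => TangentSpace (𝓡 d) x) c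
  refine ⟨C, hC, ?_⟩
  filter_upwards [h, extChartAt_source_mem_nhds (I := 𝓡 d) c] with x hx hxs u
  have h1 := ContinuousLinearMap.le_of_opNorm_le _ hx.le u
  refine le_trans (le_of_eq ?_) h1
  have hs : x ∈ (chartAt (Rd d) c).source := by simpa using hxs
  have h2 := TangentBundle.continuousLinearMapAt_trivializationAt (I := 𝓡 d) hs
  exact congrArg (fun A : TangentSpace (𝓡 d) x →L[ℝ] Rd d => ‖A u‖) h2.symm

/-- A dual frame controls the norm. -/
theorem sq_norm_le_of_chartDeriv {c x : M} (hx : x ∈ (extChartAt (𝓡 d) c).source)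
    {Z : Fin d → TangentSpace (𝓡 d) x}
    (hZ : ∀ a, chartDeriv d c x (Z a) = EuclideanSpace.basisFun (Fin d) ℝ a) {C : ℝ}
    (hC : ∀ u : TangentSpace (𝓡 d) x, ‖chartDeriv d c x u‖ ≤ C * ‖u‖)
    (u : TangentSpace (𝓡 d) x) : ‖u‖ ^ 2 ≤ C ^ 2 * ∑ a, inner ℝ u (Z a) ^ 2 := by
  set w := chartDeriv d c x u with hw
  have hu : u = ∑ a, w a • Z a := by
    refine chartDeriv_injective hx ?_
    rw [map_sum]
    simp_rw [map_smul, hZ]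
    exact ((EuclideanSpace.basisFun (Fin d) ℝ).sum_repr w).symm
  have h1 : ‖u‖ ^ 2 = ∑ a, w a * inner ℝ u (Z a) := by
    rw [← real_inner_self_eq_norm_sq]
    have h : inner ℝ u u = inner ℝ u (∑ a, w a • Z a) := by rw [← hu]
    rw [h, inner_sum]
    exact Finset.sum_congr rfl fun a _ => real_inner_smul_right _ _ _
  have h2 : (‖u‖ ^ 2) ^ 2 ≤ (∑ a, w a ^ 2) * ∑ a, inner ℝ u (Z a) ^ 2 := by
    rw [h1]
    exact Finset.sum_mul_sq_le_sq_mul_sq _ _ _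
  have h3 : ∑ a, w a ^ 2 ≤ C ^ 2 * ‖u‖ ^ 2 := by
    have h4 : ∑ a, w a ^ 2 = ‖w‖ ^ 2 := by
      rw [EuclideanSpace.norm_sq_eq]
      simp
    rw [h4, ← mul_pow]
    exact pow_le_pow_left₀ (norm_nonneg _) (hC u) 2
  have hS : 0 ≤ ∑ a, inner ℝ u (Z a) ^ 2 := Finset.sum_nonneg fun _ _ => sq_nonneg _
  rcases eq_or_lt_of_le (sq_nonneg ‖u‖) with h | h
  · rw [← h]
    positivity
  · have h5 := h2.trans (mul_le_mul_of_nonneg_right h3 hS)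
    nlinarith

/-- Finitely many smooth vector fields that control the metric, and closed forms that, together
with them, determine all alternating forms. -/
structure FormFrame (d n : ℕ) (M : Type*) [TopologicalSpace M] [ChartedSpace (Rd d) M]
    [IsManifold (𝓡 d) ∞ M] [RiemannianBundle (fun x : M => TangentSpace (𝓡 d) x)] where
  N : ℕ
  Z : Fin N × Fin d → ∀ x : M, TangentSpace (𝓡 d) x
  smooth : ∀ j, IsSmoothField (d := d) (Z j)
  C : ℝ
  sq_norm_le : ∀ (x : M) (u : TangentSpace (𝓡 d) x), ‖u‖ ^ 2 ≤ C * ∑ j, inner ℝ u (Z j x) ^ 2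
  χ : Fin N → C(M, ℝ)
  χ_mem : ∀ l x, χ l x ∈ Icc (0 : ℝ) 1
  form : Fin N → (Fin n → Fin d) → DiffForm d M n
  closed : ∀ l J, (form l J).IsClosed
  expansion : ∀ (α : ∀ x : M, TangentSpace (𝓡 d) x [⋀^Fin n]→L[ℝ] ℝ) (x : M)
    (v : Fin n → TangentSpace (𝓡 d) x),
    α x v = ∑ l, χ l x * ∑ J, (form l J).toFun x v * α x fun i => Z (l, J i) x

theorem nonempty_formFrame [T2Space M] [CompactSpace M] [IsContMDiffRiemannianBundle (𝓡 d) ∞ (Rd d)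
    (fun x : M => TangentSpace (𝓡 d) x)] : Nonempty (FormFrame d n M) := by
  have : LocallyCompactSpace M := ChartedSpace.locallyCompactSpace (Rd d) M
  choose Z A hZ hA hloc using exists_local_expansion (d := d) (M := M) n
  choose C hC hCloc using eventually_norm_chartDeriv_le (d := d) (M := M)
  have hW := fun c => eventually_nhds_iff.1 ((hloc c).and (hCloc c))
  choose W hWprop hWo hWc using hW
  obtain ⟨t, ht⟩ := CompactSpace.elim_nhds_subcover W fun c => (hWo c).mem_nhds (hWc c)
  let c : Fin t.card → M := fun l => (t.equivFin.symm l).1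
  have hcov : (univ : Set M) ⊆ ⋃ l, W (c l) := by
    intro x _
    have hx : x ∈ ⋃ y ∈ t, W y := by
      rw [ht]
      trivial
    simp only [mem_iUnion] at hx ⊢
    obtain ⟨y, hy, hxy⟩ := hx
    exact ⟨t.equivFin ⟨y, hy⟩, by simpa [c] using hxy⟩
  obtain ⟨χ, hχs, hχ1, hχI, -⟩ := exists_continuous_sum_one_of_isOpen_isCompact
    (fun l => hWo (c l)) isCompact_univ hcov
  refine ⟨⟨t.card, fun j => Z (c j.1) j.2, fun j => hZ _ _, ∑ l, C (c l) ^ 2, ?_, χ, hχI,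
    fun l => A (c l), fun l => hA (c l), ?_⟩⟩
  · intro x u
    obtain ⟨l, hl⟩ := mem_iUnion.1 (hcov (mem_univ x))
    obtain ⟨⟨hxs, hxZ, -⟩, hxC⟩ := hWprop _ x hl
    have h1 := sq_norm_le_of_chartDeriv hxs (Z := fun a => Z (c l) a x) hxZ hxC u
    have h2 : C (c l) ^ 2 ≤ ∑ l, C (c l) ^ 2 :=
      Finset.single_le_sum (f := fun l => C (c l) ^ 2) (fun _ _ => sq_nonneg _) (Finset.mem_univ l)
    have h3 : ∑ a, inner ℝ u (Z (c l) a x) ^ 2 ≤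
        ∑ j : Fin t.card × Fin d, inner ℝ u (Z (c j.1) j.2 x) ^ 2 := by
      rw [Fintype.sum_prod_type]
      exact Finset.single_le_sum (f := fun l => ∑ a, inner ℝ u (Z (c l) a x) ^ 2)
        (fun _ _ => Finset.sum_nonneg fun _ _ => sq_nonneg _) (Finset.mem_univ l)
    refine h1.trans (mul_le_mul h2 h3 (Finset.sum_nonneg fun _ _ => sq_nonneg _) ?_)
    exact Finset.sum_nonneg fun _ _ => sq_nonneg _
  · intro α x v
    have h1 : ∑ l, χ l x = 1 := by simpa using hχ1 (mem_univ x)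
    rw [← one_mul (α x v), ← h1, Finset.sum_mul]
    refine Finset.sum_congr rfl fun l _ => ?_
    by_cases hl : x ∈ W (c l)
    · obtain ⟨⟨-, -, hexp⟩, -⟩ := hWprop _ x hl
      rw [hexp α v]
    · have : χ l x = 0 := by
        by_contra h0
        exact hl (hχs l (subset_tsupport _ h0))
      rw [this, zero_mul, zero_mul]

end ChartDeriv

section Metric

variable {d n : ℕ} {M : Type*} [TopologicalSpace M] [ChartedSpace (Rd d) M]
  [IsManifold (𝓡 d) ∞ M]
  [RiemannianBundle (fun x : M => TangentSpace (𝓡 d) x)]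

/-- The fibre variable `vᵢ`, with the other variables fixed. -/
def slotInsert (p : TnM d n M) (i : Fin n) (w : TangentSpace (𝓡 d) p.proj) : TnM d n M :=
  ⟨p.proj, Function.update (β := fun _ => TangentSpace (𝓡 d) p.proj) p.snd i w⟩

theorem contMDiff_slotInsert (p : TnM d n M) (i : Fin n) :
    ContMDiff 𝓘(ℝ, TangentSpace (𝓡 d) p.proj) (tnModel d n) ∞ (slotInsert p i) := by
  intro w
  refine contMDiffAt_tnM contMDiffAt_const fun j => ?_
  have hx : p.proj ∈ (extChartAt (𝓡 d) p.proj).source := mem_extChartAt_source _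
  have h : ∀ z : TangentSpace (𝓡 d) p.proj, (tnTriv n p.proj (slotInsert p i z)).2 j =
      chartDeriv d p.proj p.proj
        (Function.update (β := fun _ => TangentSpace (𝓡 d) p.proj) p.snd i z j) :=
    fun z => tnTriv_apply p.proj (slotInsert p i z) hx j
  by_cases hj : j = i
  · subst hj
    refine ContMDiffAt.congr_of_eventuallyEq
      (chartDeriv d p.proj p.proj).contDiff.contDiffAt.contMDiffAt
      (Eventually.of_forall fun z => (h z).trans ?_)
    exact congrArg (chartDeriv d p.proj p.proj)
      (Function.update_self (β := fun _ => TangentSpace (𝓡 d) p.proj) j z p.snd)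
  · refine ContMDiffAt.congr_of_eventuallyEq
      (contMDiffAt_const (c := chartDeriv d p.proj p.proj (p.snd j)))
      (Eventually.of_forall fun z => (h z).trans ?_)
    exact congrArg (chartDeriv d p.proj p.proj)
      (Function.update_of_ne (β := fun _ => TangentSpace (𝓡 d) p.proj) hj z p.snd)

omit [IsManifold (𝓡 d) ∞ M] in
theorem inner_vertGrad_of_differentiableAt {f : TnM d n M → ℝ} {p : TnM d n M} {i : Fin n}
    (hf : DifferentiableAt ℝ (fun w => f (slotInsert p i w)) (p.snd i))
    (Z : ∀ x : M, TangentSpace (𝓡 d) x) :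
    inner ℝ (vertGrad f p i) (Z p.proj) = slotDeriv i Z f p 0 := by
  have h1 : inner ℝ (vertGrad f p i) (Z p.proj) =
      fderiv ℝ (fun w => f (slotInsert p i w)) (p.snd i) (Z p.proj) := by
    simp only [vertGrad, gradient]
    exact InnerProductSpace.toDual_symm_apply
  rw [h1]
  set v : TangentSpace (𝓡 d) p.proj := p.snd i with hv
  have hl : HasDerivAt (fun s : ℝ => v + s • Z p.proj) (Z p.proj) 0 := by
    simpa using ((hasDerivAt_id (0 : ℝ)).smul_const (Z p.proj)).const_add v
  have hf' : HasFDerivAt (fun w => f (slotInsert p i w))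
      (fderiv ℝ (fun w => f (slotInsert p i w)) v) (v + (0 : ℝ) • Z p.proj) := by
    rw [zero_smul, add_zero]
    exact hf.hasFDerivAt
  have h2 := hf'.comp_hasDerivAt 0 hl
  refine h2.deriv.symm.trans ?_
  rw [slotDeriv]
  congr 1
  funext s
  simp only [Function.comp_apply, slotInsert, slotMap, one_smul]
  rfl

theorem inner_vertGrad {f : TnM d n M → ℝ} (hf : ContMDiff (tnModel d n) 𝓘(ℝ, ℝ) ∞ f)
    (p : TnM d n M) (i : Fin n) (Z : ∀ x : M, TangentSpace (𝓡 d) x) :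
    inner ℝ (vertGrad f p i) (Z p.proj) = slotDeriv i Z f p 0 := by
  refine inner_vertGrad_of_differentiableAt ?_ Z
  exact (hf.comp (contMDiff_slotInsert p i)).contDiff.differentiable (by simp) _

omit [IsManifold (𝓡 d) ∞ M] in
theorem inner_vertGrad_formFun (α : ∀ x : M, TangentSpace (𝓡 d) x [⋀^Fin n]→L[ℝ] ℝ)
    (p : TnM d n M) (i : Fin n) (Z : ∀ x : M, TangentSpace (𝓡 d) x) :
    inner ℝ (vertGrad (formFun α) p i) (Z p.proj) = slotDeriv i Z (formFun α) p 0 := by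
  refine inner_vertGrad_of_differentiableAt ?_ Z
  have h : (fun w => formFun α (slotInsert p i w)) =
      (α p.proj).toContinuousMultilinearMap.toContinuousLinearMap p.snd i := rfl
  rw [h]
  exact ContinuousLinearMap.differentiableAt _

omit [IsManifold (𝓡 d) ∞ M] in
theorem abs_form_le_of_comassLEOne {α : DiffForm d M n} (hα : ComassLEOne α) (x : M)
    (v : Fin n → TangentSpace (𝓡 d) x) : |α.toFun x v| ≤ ∏ i, ‖v i‖ := by
  by_cases h : ∃ i, v i = 0
  · obtain ⟨i, hi⟩ := h
    rw [(α.toFun x).map_coord_zero i hi, abs_zero]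
    exact Finset.prod_nonneg fun _ _ => norm_nonneg _
  · push Not at h
    have h1 : v = fun i => ‖v i‖ • (‖v i‖⁻¹ • v i) := by
      funext i
      rw [smul_smul, mul_inv_cancel₀ (norm_ne_zero_iff.2 (h i)), one_smul]
    have h2 := (α.toFun x).toMultilinearMap.map_smul_univ (fun i => ‖v i‖)
      (fun i => ‖v i‖⁻¹ • v i)
    have h3 : α.toFun x v = (∏ i, ‖v i‖) * α.toFun x fun i => ‖v i‖⁻¹ • v i := by
      conv_lhs => rw [h1]
      exact h2
    rw [h3, abs_mul, abs_of_nonneg (Finset.prod_nonneg fun _ _ => norm_nonneg _)]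
    refine mul_le_of_le_one_right (Finset.prod_nonneg fun _ _ => norm_nonneg _) (hα x _ fun i => ?_)
    rw [norm_smul, norm_inv, norm_norm, inv_mul_cancel₀ (norm_ne_zero_iff.2 (h i))]

omit [RiemannianBundle (fun x : M => TangentSpace (𝓡 d) x)] in
theorem continuous_tnComponent (i : Fin n) : Continuous
    (fun p : TnM d n M => (⟨p.proj, p.snd i⟩ : TangentBundle (𝓡 d) M)) := by
  rw [continuous_iff_continuousAt]
  intro p
  refine (FiberBundle.continuousAt_totalSpace (Rd d) _).2 ⟨continuous_tnProj.continuousAt, ?_⟩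
  refine (contMDiffAt_tnTriv p.proj p (mem_extChartAt_source _) i).continuousAt.congr ?_
  filter_upwards [continuous_tnProj.continuousAt.eventually
    (extChartAt_source_mem_nhds (I := 𝓡 d) p.proj)] with q hq
  exact (tnTriv_apply p.proj q hq i).trans (tangentTriv_apply p.proj q.proj hq (q.snd i)).symm

variable [IsContMDiffRiemannianBundle (𝓡 d) ∞ (Rd d) (fun x : M => TangentSpace (𝓡 d) x)]

theorem continuous_norm_field {X : Type*} [TopologicalSpace X] {b : X → M}
    {u : ∀ z : X, TangentSpace (𝓡 d) (b z)}
    (hu : Continuous (fun z => (⟨b z, u z⟩ : TangentBundle (𝓡 d) M))) :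
    Continuous (fun z => ‖u z‖) := by
  have := isContinuousRiemannianBundle_tangent (d := d) (M := M)
  have h : Continuous (fun z => (inner ℝ (u z) (u z) : ℝ)) :=
    Continuous.inner_bundle (F := Rd d) (E := fun x : M => TangentSpace (𝓡 d) x) hu hu
  have h2 : (fun z => ‖u z‖) = fun z => √(inner ℝ (u z) (u z) : ℝ) := by
    funext z
    rw [real_inner_self_eq_norm_sq, Real.sqrt_sq (norm_nonneg _)]
  rw [h2]
  exact h.sqrt

theorem exists_volFun_le {K : Set (TnM d n M)} (hK : IsCompact K) :
    ∃ C : ℝ, ∀ p ∈ K, volFun p ≤ ENNReal.ofReal C := by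
  have hc : Continuous (fun p : TnM d n M => ∏ i, ‖(p.snd i : TangentSpace (𝓡 d) p.proj)‖) :=
    continuous_finsetProd _ fun i _ => continuous_norm_field (continuous_tnComponent i)
  obtain ⟨C, hC⟩ := hK.bddAbove_image hc.continuousOn
  refine ⟨C, fun p hp => iSup₂_le fun α hα => ENNReal.ofReal_le_ofReal ?_⟩
  exact ((le_abs_self _).trans (abs_form_le_of_comassLEOne hα p.proj p.snd)).trans
    (hC (mem_image_of_mem _ hp))

theorem exists_norm_field_le [CompactSpace M] {Z : ∀ x : M, TangentSpace (𝓡 d) x}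
    (hZ : IsSmoothField (d := d) Z) : ∃ C : ℝ, ∀ x, ‖Z x‖ ≤ C := by
  obtain ⟨C, hC⟩ := isCompact_univ.bddAbove_image
    (continuous_norm_field (b := id) (u := Z) hZ.continuous).continuousOn
  exact ⟨C, fun x => hC (mem_image_of_mem _ (mem_univ x))⟩

end Metric

section Perturbation

variable {X : Type*} [TopologicalSpace X] [MeasurableSpace X] [BorelSpace X]

/-- Data of a compactly supported signed perturbation `θ - κ μ` of `μ`, of total mass zero. -/
structure IsPerturbation (μ : Measure X) (κ : X → ℝ) (θ : Measure X) (K : Set X) (C : ℝ) :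
    Prop where
  measurable : Measurable κ
  nonneg : ∀ p, 0 ≤ κ p
  le : ∀ p, κ p ≤ C
  eq_zero : ∀ p, p ∉ K → κ p = 0
  finite : IsFiniteMeasure θ
  compl : θ Kᶜ = 0
  compact : IsCompact K
  mass : θ.real univ = ∫ p, κ p ∂μ
  pos : 0 < C

/-- The measure `(1 - s κ) μ + s θ`. -/
def perturb (μ : Measure X) (κ : X → ℝ) (θ : Measure X) (s : ℝ) : Measure X :=
  μ.withDensity (fun p => (Real.toNNReal (1 - s * κ p) : ENNReal)) + ENNReal.ofReal s • θ

namespace IsPerturbation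

variable {μ : Measure X} {κ : X → ℝ} {θ : Measure X} {K : Set X} {C : ℝ}

omit [BorelSpace X] in
theorem ae_mem (h : IsPerturbation μ κ θ K C) : ∀ᵐ p ∂θ, p ∈ K :=
  h.compl

theorem integrable (h : IsPerturbation μ κ θ K C) {f : X → ℝ} (hf : Continuous f) :
    Integrable f θ := by
  have := h.finite
  obtain ⟨B, hB⟩ := h.compact.exists_bound_of_continuousOn hf.continuousOn
  refine Integrable.of_bound hf.measurable.aestronglyMeasurable B ?_
  filter_upwards [h.ae_mem] with p hp using hB p hp

theorem integrable_mul [IsFiniteMeasure μ] (h : IsPerturbation μ κ θ K C) {f : X → ℝ}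
    (hf : Continuous f) : Integrable (fun p => κ p * f p) μ := by
  obtain ⟨B, hB⟩ := h.compact.exists_bound_of_continuousOn hf.continuousOn
  refine Integrable.of_bound (h.measurable.mul hf.measurable).aestronglyMeasurable (C * |B|) ?_
  refine Eventually.of_forall fun p => ?_
  rw [norm_mul, Real.norm_of_nonneg (h.nonneg p)]
  by_cases hp : p ∈ K
  · exact mul_le_mul (h.le p) ((hB p hp).trans (le_abs_self B)) (norm_nonneg _) h.pos.le
  · rw [h.eq_zero p hp, zero_mul]
    exact mul_nonneg h.pos.le (abs_nonneg _)

omit [BorelSpace X] in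
theorem measurable_density (h : IsPerturbation μ κ θ K C) (s : ℝ) :
    Measurable (fun p => Real.toNNReal (1 - s * κ p)) :=
  (measurable_const.sub (measurable_const.mul h.measurable)).real_toNNReal

omit [BorelSpace X] in
theorem density_nonneg (h : IsPerturbation μ κ θ K C) {s : ℝ} (hs : s ≤ C⁻¹) (p : X) :
    0 ≤ 1 - s * κ p := by
  have h1 : s * κ p ≤ C⁻¹ * C := mul_le_mul hs (h.le p) (h.nonneg p) (inv_nonneg.2 h.pos.le)
  rw [inv_mul_cancel₀ h.pos.ne'] at h1
  linarith

theorem integrable_perturb_iff [IsFiniteMeasure μ] (h : IsPerturbation μ κ θ K C) {s : ℝ}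
    (hs : s ≤ C⁻¹) {f : X → ℝ} (hf : Continuous f) :
    Integrable f (perturb μ κ θ s) ↔ Integrable f μ := by
  have h1 : Integrable f (ENNReal.ofReal s • θ) :=
    (h.integrable hf).smul_measure ENNReal.ofReal_ne_top
  have h2 : Integrable f (perturb μ κ θ s) ↔ Integrable
      (fun p => (Real.toNNReal (1 - s * κ p)) • f p) μ := by
    rw [perturb, integrable_add_measure, and_iff_left h1,
      integrable_withDensity_iff_integrable_smul (h.measurable_density s)]
  have h3 : (fun p => (Real.toNNReal (1 - s * κ p)) • f p) =
      fun p => f p - s * (κ p * f p) := by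
    funext p
    rw [NNReal.smul_def, Real.coe_toNNReal _ (h.density_nonneg hs p), smul_eq_mul]
    ring
  have h4 : Integrable (fun p => s * (κ p * f p)) μ := (h.integrable_mul hf).const_mul s
  rw [h2, h3]
  refine ⟨fun h5 => ?_, fun h5 => h5.sub h4⟩
  refine (h5.add h4).congr (Eventually.of_forall fun p => ?_)
  simp

theorem integral_perturb [IsFiniteMeasure μ] (h : IsPerturbation μ κ θ K C) {s : ℝ}
    (hs0 : 0 ≤ s) (hs : s ≤ C⁻¹) {f : X → ℝ} (hf : Continuous f) (hfμ : Integrable f μ) :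
    ∫ p, f p ∂(perturb μ κ θ s) = ∫ p, f p ∂μ + s * (∫ p, f p ∂θ - ∫ p, κ p * f p ∂μ) := by
  have h0 := (h.integrable_perturb_iff hs hf).2 hfμ
  rw [perturb, integrable_add_measure] at h0
  rw [perturb, integral_add_measure h0.1 h0.2,
    integral_withDensity_eq_integral_smul (h.measurable_density s), integral_smul_measure]
  have h3 : (fun p => (Real.toNNReal (1 - s * κ p)) • f p) =
      fun p => f p - s * (κ p * f p) := by
    funext p
    rw [NNReal.smul_def, Real.coe_toNNReal _ (h.density_nonneg hs p), smul_eq_mul]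
    ring
  rw [h3, integral_sub hfμ ((h.integrable_mul hf).const_mul s), integral_const_mul,
    ENNReal.toReal_ofReal hs0, smul_eq_mul]
  ring

theorem integral_perturb_eq [IsFiniteMeasure μ] (h : IsPerturbation μ κ θ K C) {s : ℝ}
    (hs0 : 0 ≤ s) (hs : s ≤ C⁻¹) {f : X → ℝ} (hf : Continuous f)
    (hfθ : ∫ p, f p ∂θ = ∫ p, κ p * f p ∂μ) :
    ∫ p, f p ∂(perturb μ κ θ s) = ∫ p, f p ∂μ := by
  by_cases hfμ : Integrable f μ
  · rw [h.integral_perturb hs0 hs hf hfμ, hfθ, sub_self, mul_zero, add_zero]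
  · rw [integral_undef hfμ,
      integral_undef (mt (h.integrable_perturb_iff hs hf).1 hfμ)]

omit [BorelSpace X] in
theorem withDensity_le (h : IsPerturbation μ κ θ K C) {s : ℝ} (hs0 : 0 ≤ s) :
    μ.withDensity (fun p => (Real.toNNReal (1 - s * κ p) : ENNReal)) ≤ μ := by
  conv_rhs => rw [← withDensity_one (μ := μ)]
  refine withDensity_mono (Eventually.of_forall fun p => ?_)
  have : Real.toNNReal (1 - s * κ p) ≤ 1 := by
    rw [Real.toNNReal_le_one]
    have := mul_nonneg hs0 (h.nonneg p)
    linarith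
  exact ENNReal.coe_le_one_iff.2 this

theorem isProbabilityMeasure_perturb [IsProbabilityMeasure μ] (h : IsPerturbation μ κ θ K C)
    {s : ℝ} (hs0 : 0 ≤ s) (hs : s ≤ C⁻¹) : IsProbabilityMeasure (perturb μ κ θ s) := by
  have := h.finite
  have h1 : ∫ p, (1 : ℝ) ∂(perturb μ κ θ s) = ∫ p, (1 : ℝ) ∂μ :=
    h.integral_perturb_eq hs0 hs continuous_const (by simpa using h.mass)
  have h2 : (perturb μ κ θ s).real univ = 1 := by simpa using h1
  refine ⟨?_⟩
  rwa [Measure.real, ENNReal.toReal_eq_one_iff] at h2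

omit [BorelSpace X] in
theorem lintegral_perturb_lt_top [IsFiniteMeasure μ] (h : IsPerturbation μ κ θ K C)
    {s : ℝ} (hs0 : 0 ≤ s) {f : X → ENNReal} (hf : ∫⁻ p, f p ∂μ < ⊤) {B : ℝ}
    (hB : ∀ p ∈ K, f p ≤ ENNReal.ofReal B) : ∫⁻ p, f p ∂(perturb μ κ θ s) < ⊤ := by
  have := h.finite
  rw [perturb, lintegral_add_measure, lintegral_smul_measure]
  refine ENNReal.add_lt_top.2 ⟨(lintegral_mono' (h.withDensity_le hs0) le_rfl).trans_lt hf, ?_⟩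
  refine ENNReal.mul_lt_top ENNReal.ofReal_lt_top ?_
  have h1 : ∫⁻ p, f p ∂θ ≤ ∫⁻ _, ENNReal.ofReal B ∂θ :=
    lintegral_mono_ae (by filter_upwards [h.ae_mem] with p hp using hB p hp)
  refine h1.trans_lt ?_
  rw [lintegral_const]
  exact ENNReal.mul_lt_top ENNReal.ofReal_lt_top (measure_lt_top _ _)

end IsPerturbation

end Perturbation

section Criticality

variable {d : ℕ} {M : Type*} [TopologicalSpace M] [ChartedSpace (Rd d) M] [IsManifold (𝓡 d) ∞ M]

section Derivative

variable {E H P : Type*} [NormedAddCommGroup E] [NormedSpace ℝ E] [TopologicalSpace H]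
  {I : ModelWithCorners ℝ E H} [TopologicalSpace P] [ChartedSpace H P] [MeasurableSpace P]
  [BorelSpace P] {μ : Measure P} {κ : P → ℝ} {θ : Measure P} {K : Set P} {C : ℝ}

omit [MeasurableSpace P] [BorelSpace P] in
theorem testFunctions_continuous (f : testFunctions I P) : Continuous (f : P → ℝ) :=
  f.2.1.continuous

/-- The distribution `θ - κ μ`. -/
def perturbDistribution [IsFiniteMeasure μ] (h : IsPerturbation μ κ θ K C) :
    testFunctions I P →ₗ[ℝ] ℝ where
  toFun f := ∫ p, (f : P → ℝ) p ∂θ - ∫ p, κ p * (f : P → ℝ) p ∂μ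
  map_add' f g := by
    have h1 := integral_add (h.integrable (testFunctions_continuous f))
      (h.integrable (testFunctions_continuous g))
    have h2 := integral_add (h.integrable_mul (testFunctions_continuous f))
      (h.integrable_mul (testFunctions_continuous g))
    simp only [Submodule.coe_add, Pi.add_apply, mul_add]
    rw [h1, h2]
    ring
  map_smul' c f := by
    simp only [Submodule.coe_smul, Pi.smul_apply, smul_eq_mul, RingHom.id_apply,
      mul_left_comm _ c, integral_const_mul]
    ring

theorem perturbDistribution_apply [IsFiniteMeasure μ] (h : IsPerturbation μ κ θ K C)
    (f : testFunctions I P) : perturbDistribution h f =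
      ∫ p, (f : P → ℝ) p ∂θ - ∫ p, κ p * (f : P → ℝ) p ∂μ := rfl

theorem isDistribution_perturbDistribution [IsFiniteMeasure μ] (h : IsPerturbation μ κ θ K C) :
    IsDistribution (perturbDistribution (I := I) h) := by
  have := h.finite
  intro e _ K' _ hK'e
  refine ⟨0, θ.real univ + C * μ.real univ, fun f hf B hB hfB => ?_⟩
  have hb : ∀ p, ‖(f : P → ℝ) p‖ ≤ B := by
    intro p
    by_cases hp : p ∈ K'
    · have h1 := hfB 0 le_rfl p hp
      rw [norm_iteratedFDeriv_zero, Function.comp_apply, e.extend_left_inv (hK'e hp)] at h1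
      exact h1
    · rw [image_eq_zero_of_notMem_tsupport (fun h' => hp (hf h')), norm_zero]
      exact hB
  have h1 : |∫ p, (f : P → ℝ) p ∂θ| ≤ B * θ.real univ :=
    norm_integral_le_of_norm_le_const (Eventually.of_forall hb)
  have hκb : ∀ p, ‖κ p * (f : P → ℝ) p‖ ≤ C * B := by
    intro p
    rw [norm_mul, Real.norm_of_nonneg (h.nonneg p)]
    exact mul_le_mul (h.le p) (hb p) (norm_nonneg _) h.pos.le
  have h2 : |∫ p, κ p * (f : P → ℝ) p ∂μ| ≤ C * B * μ.real univ :=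
    norm_integral_le_of_norm_le_const (Eventually.of_forall hκb)
  rw [perturbDistribution_apply]
  refine (abs_sub _ _).trans ?_
  nlinarith

end Derivative

theorem isMildDistribution_perturbDistribution {n : ℕ} {μ : Measure (TnM d n M)}
    [IsFiniteMeasure μ] {κ : TnM d n M → ℝ} {θ : Measure (TnM d n M)} {K : Set (TnM d n M)} {C : ℝ}
    (h : IsPerturbation μ κ θ K C) :
    IsMildDistribution (perturbDistribution (I := tnModel d n) h) := by
  have h0 := isDistribution_perturbDistribution (I := tnModel d n) h
  refine ⟨h0, fun α ψ _ φ hφ => ?_⟩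
  have hfin := ψ.locallyFinite.finite_nonempty_inter_compact h.compact
  refine summable_of_hasFiniteSupport (hfin.subset fun i hi => ?_)
  by_contra hne
  refine hi ?_
  have hz : ∀ p ∈ K, (φ i : TnM d n M → ℝ) p = 0 := by
    intro p hp
    rw [hφ]
    by_contra h0
    exact hne ⟨p, fun h' => h0 (by rw [h', zero_mul]), hp⟩
  have h1 : ∫ p, (φ i : TnM d n M → ℝ) p ∂θ = 0 := by
    refine integral_eq_zero_of_ae ?_
    filter_upwards [h.ae_mem] with p hp using hz p hp
  have h2 : ∫ p, κ p * (φ i : TnM d n M → ℝ) p ∂μ = 0 := by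
    refine integral_eq_zero_of_ae (Eventually.of_forall fun p => ?_)
    by_cases hp : p ∈ K
    · simp [hz p hp]
    · simp [h.eq_zero p hp]
  change |perturbDistribution h (φ i)| = 0
  rw [perturbDistribution_apply, h1, h2, sub_zero, abs_zero]

variable [RiemannianBundle (fun x : M => TangentSpace (𝓡 d) x)]
  [IsContMDiffRiemannianBundle (𝓡 d) ∞ (Rd d) (fun x : M => TangentSpace (𝓡 d) x)]

/-- Criticality tested against perturbations that annihilate the closed forms. -/
theorem integral_le_of_isPerturbation {k : ℕ} {L : TnM d (k + 1) M → ℝ} (hL : Continuous L)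
    {μ : Measure (TnM d (k + 1) M)} (hμ : IsHolonomic μ) (hcrit : IsCriticalInHomologyClass L μ)
    {κ : TnM d (k + 1) M → ℝ} {θ : Measure (TnM d (k + 1) M)} {K : Set (TnM d (k + 1) M)} {C : ℝ}
    (h : IsPerturbation μ κ θ K C)
    (hform : ∀ α : DiffForm d M (k + 1), α.IsClosed →
      ∫ p, formFun α.toFun p ∂θ = ∫ p, κ p * formFun α.toFun p ∂μ) :
    ∫ p, κ p * L p ∂μ ≤ ∫ p, L p ∂θ := by
  have := hμ.prob
  have hC : 0 < C⁻¹ := inv_pos.2 h.pos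
  let ν : ℝ → Measure (TnM d (k + 1) M) := fun t => perturb μ κ θ (min t C⁻¹)
  have hs0 : ∀ t : ℝ, 0 ≤ t → 0 ≤ min t C⁻¹ := fun t ht => le_min ht hC.le
  have hderiv : ∀ f : TnM d (k + 1) M → ℝ, Continuous f → Integrable f μ →
      HasDerivWithinAt (fun t => ∫ p, f p ∂(ν t)) (∫ p, f p ∂θ - ∫ p, κ p * f p ∂μ) (Ici 0) 0 := by
    intro f hf hfμ
    have h1 : HasDerivWithinAt (fun t : ℝ => ∫ p, f p ∂μ + t * (∫ p, f p ∂θ - ∫ p, κ p * f p ∂μ))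
        (∫ p, f p ∂θ - ∫ p, κ p * f p ∂μ) (Ici 0) 0 := by
      have := ((hasDerivAt_id (0 : ℝ)).mul_const
        (∫ p, f p ∂θ - ∫ p, κ p * f p ∂μ)).const_add (∫ p, f p ∂μ)
      simpa using this.hasDerivWithinAt
    have h2 : ∀ t ∈ Ici (0 : ℝ), t < C⁻¹ → ∫ p, f p ∂(ν t) =
        ∫ p, f p ∂μ + t * (∫ p, f p ∂θ - ∫ p, κ p * f p ∂μ) := by
      intro t ht htC
      have h3 : ν t = perturb μ κ θ t := by simp only [ν, min_eq_left htC.le]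
      rw [h3]
      exact h.integral_perturb ht htC.le hf hfμ
    refine h1.congr_of_eventuallyEq ?_ (h2 0 self_mem_Ici hC)
    filter_upwards [self_mem_nhdsWithin, mem_nhdsWithin_of_mem_nhds (Iio_mem_nhds hC)] with t ht htC
    exact h2 t ht htC
  have hvar : IsVariation μ ν := by
    refine ⟨fun t ht => ⟨?_, ?_, fun α => ?_⟩, ?_, ?_⟩
    · exact h.isProbabilityMeasure_perturb (hs0 t ht) (min_le_right _ _)
    · obtain ⟨B, hB⟩ := exists_volFun_le h.compact
      exact h.lintegral_perturb_lt_top (hs0 t ht) hμ.mild hB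
    · have h1 := h.integral_perturb_eq (hs0 t ht) (min_le_right _ _)
        (continuous_formFun α.extForm) (hform _ α.isClosed_extForm)
      exact h1.trans (hμ.exact_zero α)
    · simp only [ν, min_eq_left hC.le, perturb]
      simp
    · refine ⟨perturbDistribution h, isMildDistribution_perturbDistribution h, fun f => ?_⟩
      refine hderiv f (testFunctions_continuous f) ?_
      exact (testFunctions_continuous f).integrable_of_hasCompactSupport f.2.2
  have hfin := hcrit.2 ν hvar
    (fun t ht => funext fun α => h.integral_perturb_eq (hs0 t ht) (min_le_right _ _)
      (continuous_formFun α.1) (hform α.1 α.2))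
    (fun t ht => (h.integrable_perturb_iff (min_le_right _ _) hL).2 hcrit.1)
    _ (hderiv L hL hcrit.1)
  linarith

end Criticality

section Pieces

variable {X : Type*} [TopologicalSpace X] [MeasurableSpace X] [BorelSpace X]

/-- Transport of the mass `w μ` by `T`. -/
def transport (μ : Measure X) (w : X → ℝ) (T : X → X) : Measure X :=
  (μ.withDensity fun p => (Real.toNNReal (w p) : ENNReal)).map T

variable {μ : Measure X} {w : X → ℝ} {T : X → X} {K : Set X}

omit [TopologicalSpace X] [BorelSpace X] in
theorem isFiniteMeasure_transport (hw : Integrable w μ) : IsFiniteMeasure (transport μ w T) := by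
  have : IsFiniteMeasure (μ.withDensity fun p => (Real.toNNReal (w p) : ENNReal)) :=
    isFiniteMeasure_withDensity_ofReal hw.2
  exact Measure.isFiniteMeasure_map _ _

theorem transport_compl [T2Space X] (hT : Continuous T) (hK : IsCompact K)
    (hwK : ∀ p, w p ≠ 0 → T p ∈ K) : transport μ w T Kᶜ = 0 := by
  rw [transport, Measure.map_apply hT.measurable hK.measurableSet.compl,
    withDensity_apply _ (hT.measurable hK.measurableSet.compl)]
  refine (setLIntegral_congr_fun (hT.measurable hK.measurableSet.compl) (g := 0) ?_).trans
    (by simp)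
  intro p hp
  have : w p = 0 := by
    by_contra h
    exact hp (hwK p h)
  simp [this]

theorem integral_transport (hwm : Measurable w) (hw0 : ∀ p, 0 ≤ w p) (hT : Continuous T)
    {f : X → ℝ} (hf : Continuous f) :
    ∫ p, f p ∂(transport μ w T) = ∫ p, w p * f (T p) ∂μ := by
  rw [transport, integral_map hT.measurable.aemeasurable hf.measurable.aestronglyMeasurable,
    integral_withDensity_eq_integral_smul hwm.real_toNNReal]
  refine integral_congr_ae (Eventually.of_forall fun p => ?_)
  simp only [NNReal.smul_def, Real.coe_toNNReal _ (hw0 p), smul_eq_mul]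

/-- A finite sum of transports. -/
theorem exists_sum_transport [T2Space X] {S : Type*} [Fintype S] {w : S → X → ℝ} {T : S → X → X}
    (hwm : ∀ s, Measurable (w s)) (hw0 : ∀ s p, 0 ≤ w s p) (hw : ∀ s, Integrable (w s) μ)
    (hT : ∀ s, Continuous (T s)) (hK : IsCompact K) (hwK : ∀ s p, w s p ≠ 0 → T s p ∈ K) :
    ∃ θ : Measure X, IsFiniteMeasure θ ∧ θ Kᶜ = 0 ∧ ∀ f : X → ℝ, Continuous f →
      ∫ p, f p ∂θ = ∑ s, ∫ p, w s p * f (T s p) ∂μ := by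
  have hfin : ∀ s, IsFiniteMeasure (transport μ (w s) (T s)) :=
    fun s => isFiniteMeasure_transport (hw s)
  have hc : ∀ s, transport μ (w s) (T s) Kᶜ = 0 :=
    fun s => transport_compl (hT s) hK (hwK s)
  refine ⟨∑ s, transport μ (w s) (T s), inferInstance, ?_, fun f hf => ?_⟩
  · rw [Measure.finsetSum_apply]
    exact Finset.sum_eq_zero fun s _ => hc s
  · rw [integral_finsetSum_measure]
    · exact Finset.sum_congr rfl fun s _ => integral_transport (hwm s) (hw0 s) (hT s) hf
    · intro s _
      obtain ⟨B, hB⟩ := hK.exists_bound_of_continuousOn hf.continuousOn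
      refine Integrable.of_bound hf.measurable.aestronglyMeasurable B ?_
      have : ∀ᵐ p ∂(transport μ (w s) (T s)), p ∈ K := hc s
      filter_upwards [this] with p hp using hB p hp

end Pieces

section CriticalityTransport

variable {d : ℕ} {M : Type*} [TopologicalSpace M] [T2Space M] [ChartedSpace (Rd d) M]
  [IsManifold (𝓡 d) ∞ M] [RiemannianBundle (fun x : M => TangentSpace (𝓡 d) x)]
  [IsContMDiffRiemannianBundle (𝓡 d) ∞ (Rd d) (fun x : M => TangentSpace (𝓡 d) x)]

theorem integral_le_sum_transport {k : ℕ} {L : TnM d (k + 1) M → ℝ} (hL : Continuous L)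
    {μ : Measure (TnM d (k + 1) M)} (hμ : IsHolonomic μ) (hcrit : IsCriticalInHomologyClass L μ)
    {κ : TnM d (k + 1) M → ℝ} {K : Set (TnM d (k + 1) M)} {C : ℝ} (hκm : Measurable κ)
    (hκ0 : ∀ p, 0 ≤ κ p) (hκC : ∀ p, κ p ≤ C) (hκK : ∀ p, p ∉ K → κ p = 0) (hK : IsCompact K)
    {S : Type*} [Fintype S] {w : S → TnM d (k + 1) M → ℝ}
    {T : S → TnM d (k + 1) M → TnM d (k + 1) M}
    (hwm : ∀ s, Measurable (w s)) (hw0 : ∀ s p, 0 ≤ w s p) (hw : ∀ s, Integrable (w s) μ)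
    (hT : ∀ s, Continuous (T s)) (hwK : ∀ s p, w s p ≠ 0 → T s p ∈ K)
    (hmass : ∑ s, ∫ p, w s p ∂μ = ∫ p, κ p ∂μ)
    (hform : ∀ α : DiffForm d M (k + 1), α.IsClosed →
      ∑ s, ∫ p, w s p * formFun α.toFun (T s p) ∂μ = ∫ p, κ p * formFun α.toFun p ∂μ) :
    ∫ p, κ p * L p ∂μ ≤ ∑ s, ∫ p, w s p * L (T s p) ∂μ := by
  have := t2Space_tnM d (k + 1) M
  obtain ⟨θ, hθ, hθK, hθi⟩ := exists_sum_transport hwm hw0 hw hT hK hwK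
  have h : IsPerturbation μ κ θ K (|C| + 1) :=
    { measurable := hκm
      nonneg := hκ0
      le := fun p => (hκC p).trans ((le_abs_self C).trans (by linarith))
      eq_zero := hκK
      finite := hθ
      compl := hθK
      compact := hK
      mass := by
        have h1 := hθi (fun _ => 1) continuous_const
        simp only [integral_const, smul_eq_mul, mul_one] at h1
        rw [h1, hmass]
      pos := by positivity }
  have h1 := integral_le_of_isPerturbation hL hμ hcrit h fun α hα => by
    rw [hθi _ (continuous_formFun α), hform α hα]
  rwa [hθi _ hL] at h1

end CriticalityTransport

section VerticalVariations

variable {d : ℕ} {M : Type*} [TopologicalSpace M] [ChartedSpace (Rd d) M]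
  [IsManifold (𝓡 d) ∞ M]

theorem isSmoothField_zero : IsSmoothField (d := d) (fun x : M => (0 : TangentSpace (𝓡 d) x)) := by
  have := isManifold_one d M
  exact contMDiff_zeroSection ℝ (TangentSpace (𝓡 d) : M → Type _)

theorem continuous_slotMap_const {n : ℕ} (i : Fin n) {Z : ∀ x : M, TangentSpace (𝓡 d) x}
    (hZ : IsSmoothField (d := d) Z) (a r : ℝ) :
    Continuous (fun p : TnM d n M => slotMap i Z p a r) :=
  (continuous_slotMap i hZ).comp (continuous_id.prodMk (continuous_const (y := (a, r))))

/-- Multiply the first vector by `a`. -/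
def scaleFirst {k : ℕ} (a : ℝ) (p : TnM d (k + 1) M) : TnM d (k + 1) M :=
  slotMap 0 (fun _ => 0) p a 0

theorem continuous_scaleFirst {k : ℕ} (a : ℝ) :
    Continuous (scaleFirst a : TnM d (k + 1) M → TnM d (k + 1) M) :=
  continuous_slotMap_const 0 isSmoothField_zero a 0

omit [IsManifold (𝓡 d) ∞ M] in
theorem formFun_scaleFirst {k : ℕ} (α : ∀ x : M, TangentSpace (𝓡 d) x [⋀^Fin (k + 1)]→L[ℝ] ℝ)
    (a : ℝ) (p : TnM d (k + 1) M) : formFun α (scaleFirst a p) = a * formFun α p := by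
  rw [scaleFirst, formFun_slotMap, zero_mul, add_zero]

theorem continuous_slotDeriv_formFun {n : ℕ} (i : Fin n) {Z : ∀ x : M, TangentSpace (𝓡 d) x}
    (hZ : IsSmoothField (d := d) Z) (α : DiffForm d M n) :
    Continuous (fun p : TnM d n M => slotDeriv i Z (formFun α.toFun) p 0) := by
  have h : (fun p : TnM d n M => slotDeriv i Z (formFun α.toFun) p 0) =
      fun p => formFun α.toFun (slotMap i Z p 0 1) := by
    funext p
    rw [slotDeriv_formFun, formFun_slotMap, zero_mul, zero_add, one_mul]
  rw [h]
  exact (continuous_formFun α).comp (continuous_slotMap_const i hZ 0 1)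

variable {X : Type*} [TopologicalSpace X] [MeasurableSpace X] [BorelSpace X]

theorem integrable_indicator_mul [T2Space X] {μ : Measure X} [IsFiniteMeasure μ] {K : Set X}
    (hK : IsCompact K) (r : ℝ) {f : X → ℝ} (hf : Continuous f) :
    Integrable (fun p => K.indicator (fun _ => r) p * f p) μ := by
  obtain ⟨B, hB⟩ := hK.exists_bound_of_continuousOn hf.continuousOn
  refine Integrable.of_bound ((measurable_const.indicator hK.measurableSet).mul
    hf.measurable).aestronglyMeasurable (|r| * |B|) (Eventually.of_forall fun p => ?_)
  by_cases hp : p ∈ K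
  · rw [indicator_of_mem hp, norm_mul, Real.norm_eq_abs r]
    exact mul_le_mul_of_nonneg_left ((hB p hp).trans (le_abs_self B)) (abs_nonneg _)
  · rw [indicator_of_notMem hp, zero_mul, norm_zero]
    positivity

theorem integrable_mul_of_support {μ : Measure X} [IsFiniteMeasure μ] {K : Set X}
    (hK : IsCompact K) {f g : X → ℝ} (hf : Continuous f) (hfK : ∀ p, p ∉ K → f p = 0)
    (hg : Continuous g) : Integrable (fun p => f p * g p) μ := by
  obtain ⟨B, hB⟩ := hK.exists_bound_of_continuousOn (hf.mul hg).continuousOn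
  refine Integrable.of_bound (hf.mul hg).measurable.aestronglyMeasurable |B|
    (Eventually.of_forall fun p => ?_)
  by_cases hp : p ∈ K
  · exact (hB p hp).trans (le_abs_self B)
  · simp [hfK p hp]

/-- Difference quotients in a vertical direction converge in the mean. -/
theorem tendsto_integral_slotMap [T2Space M] {n : ℕ} {μ : Measure (TnM d n M)} [IsFiniteMeasure μ]
    (i : Fin n) {Z : ∀ x : M, TangentSpace (𝓡 d) x} (hZ : IsSmoothField (d := d) Z)
    {L : TnM d n M → ℝ} (hL : ContMDiff (tnModel d n) 𝓘(ℝ, ℝ) ∞ L) {Y : TnM d n M → ℝ}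
    (hY : Continuous Y) {K : Set (TnM d n M)} (hK : IsCompact K) (hYK : ∀ p, p ∉ K → Y p = 0)
    {t : ℕ → ℝ} (ht0 : ∀ m, 0 < t m) (ht1 : ∀ m, t m ≤ 1) (ht : Tendsto t atTop (𝓝 0)) :
    Tendsto (fun m => ∫ p, (t m)⁻¹ * (L (slotMap i Z p 1 (t m * Y p)) - L p) ∂μ) atTop
      (𝓝 (∫ p, Y p * slotDeriv i Z L p 0 ∂μ)) := by
  obtain ⟨b, hb⟩ := hK.exists_bound_of_continuousOn hY.continuousOn
  obtain ⟨B, hB⟩ := (hK.prod (isCompact_Icc (a := -|b|) (b := |b|))).exists_bound_of_continuousOn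
    (continuous_slotDeriv i hZ hL).continuousOn
  have hcont : ∀ s : ℝ, Continuous fun p => L (slotMap i Z p 1 (s * Y p)) := fun s =>
    hL.continuous.comp ((continuous_slotMap i hZ).comp
      (continuous_id.prodMk (continuous_const.prodMk (continuous_const.mul hY))))
  refine tendsto_integral_of_dominated_convergence (fun _ => |B| * |b|) (fun m => ?_)
    (integrable_const _) (fun m => Eventually.of_forall fun p => ?_)
    (Eventually.of_forall fun p => ?_)
  · exact (continuous_const.mul ((hcont (t m)).sub
      hL.continuous)).measurable.aestronglyMeasurable
  · by_cases hp : p ∈ K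
    · have hYp : |Y p| ≤ |b| := (hb p hp).trans (le_abs_self b)
      have hs : |t m * Y p| ≤ |b| := by
        rw [abs_mul, abs_of_pos (ht0 m)]
        exact (mul_le_of_le_one_left (abs_nonneg _) (ht1 m)).trans hYp
      have h1 := (convex_Icc (-|b|) |b|).norm_image_sub_le_of_norm_hasDerivWithin_le
        (f := fun s => L (slotMap i Z p 1 s)) (f' := fun s => slotDeriv i Z L p s) (C := |B|)
        (x := 0) (y := t m * Y p)
        (fun s _ => (hasDerivAt_slotMap i hZ hL p s).hasDerivWithinAt)
        (fun s hs => (hB (p, s) ⟨hp, hs⟩).trans (le_abs_self B))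
        ⟨neg_nonpos.2 (abs_nonneg b), abs_nonneg b⟩ (abs_le.1 hs)
      simp only [slotMap_one_zero, sub_zero, Real.norm_eq_abs] at h1
      rw [Real.norm_eq_abs, abs_mul, abs_inv, abs_of_pos (ht0 m)]
      rw [abs_mul, abs_of_pos (ht0 m)] at h1
      have h2 : (t m)⁻¹ * |L (slotMap i Z p 1 (t m * Y p)) - L p| ≤
          (t m)⁻¹ * (|B| * (t m * |Y p|)) :=
        mul_le_mul_of_nonneg_left h1 (inv_nonneg.2 (ht0 m).le)
      refine h2.trans ?_
      have h3 : (t m)⁻¹ * (|B| * (t m * |Y p|)) = |B| * |Y p| := by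
        have := (ht0 m).ne'
        field_simp
      rw [h3]
      exact mul_le_mul_of_nonneg_left hYp (abs_nonneg B)
    · rw [hYK p hp, mul_zero, slotMap_one_zero, sub_self, mul_zero, norm_zero]
      positivity
  · have h1 : HasDerivAt (fun s : ℝ => L (slotMap i Z p 1 (s * Y p)))
        (slotDeriv i Z L p 0 * Y p) 0 := by
      have h2 : HasDerivAt (fun s : ℝ => s * Y p) (Y p) 0 := by
        simpa using (hasDerivAt_id (0 : ℝ)).mul_const (Y p)
      have h3 := hasDerivAt_slotMap i hZ hL p (0 * Y p)
      rw [zero_mul] at h3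
      have h4 : HasDerivAt (fun s => L (slotMap i Z p 1 s)) (slotDeriv i Z L p 0) (0 * Y p) := by
        rw [zero_mul]
        exact h3
      exact h4.comp (0 : ℝ) h2
    have h5 := hasDerivAt_iff_tendsto_slope_zero.1 h1
    have h6 : Tendsto t atTop (𝓝[≠] 0) :=
      tendsto_nhdsWithin_iff.2 ⟨ht, Eventually.of_forall fun m => (ht0 m).ne'⟩
    have h7 := h5.comp h6
    rw [mul_comm]
    refine h7.congr fun m => ?_
    simp only [Function.comp_apply, zero_add, zero_mul, slotMap_one_zero, smul_eq_mul]

end VerticalVariations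

section VariationInequality

variable {d k : ℕ} {M : Type*} [TopologicalSpace M] [T2Space M] [CompactSpace M]
  [ChartedSpace (Rd d) M] [IsManifold (𝓡 d) ∞ M]

/-- The effect on `∫ f dμ` of vertical displacements `t Y`, per unit of `t`, of adding masses `ξ` on
sections and of a compensation of the total mass inside `K₀`. -/
def variationEffect {A Λ : Type*} [Fintype A] [Fintype Λ] (μ : Measure (TnM d (k + 1) M))
    (i : A → Fin (k + 1)) (Z : A → ∀ x : M, TangentSpace (𝓡 d) x) (Y : A → TnM d (k + 1) M → ℝ)
    (W : Λ → Fin (k + 1) → ∀ x : M, TangentSpace (𝓡 d) x) (ξ : Λ → TnM d (k + 1) M → ℝ)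
    (K₀ : Set (TnM d (k + 1) M)) (c t : ℝ) (f : TnM d (k + 1) M → ℝ) : ℝ :=
  ∑ a, ∫ p, t⁻¹ * (f (slotMap (i a) (Z a) p 1 (t * Y a p)) - f p) ∂μ +
  ∑ l, ∫ p, (max (ξ l p) 0 * f (tnSection (W l) p.proj) +
    max (-ξ l p) 0 * f (scaleFirst (-1) (tnSection (W l) p.proj))) ∂μ +
  c * ∫ p, K₀.indicator (fun _ => 1) p * (f (scaleFirst 2 p) - 2 * f p) ∂μ

omit [T2Space M] in
theorem integrable_max_mul_section {μ : Measure (TnM d (k + 1) M)} {ξ : TnM d (k + 1) M → ℝ}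
    (hξ : Integrable ξ μ) {s : M → TnM d (k + 1) M} (hs : Continuous s)
    {f : TnM d (k + 1) M → ℝ} (hf : Continuous f) :
    Integrable (fun p => max (ξ p) 0 * f (s p.proj)) μ := by
  obtain ⟨B, hB⟩ := isCompact_univ.exists_bound_of_continuousOn (hf.comp hs).continuousOn
  refine (hξ.pos_part.mul_const B).mono' ?_ (Eventually.of_forall fun p => ?_)
  · exact hξ.pos_part.aestronglyMeasurable.mul
      (hf.comp (hs.comp continuous_tnProj)).measurable.aestronglyMeasurable
  · rw [norm_mul, Real.norm_of_nonneg (le_max_right _ _)]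
    exact mul_le_mul_of_nonneg_left (hB p.proj trivial) (le_max_right _ _)

variable [RiemannianBundle (fun x : M => TangentSpace (𝓡 d) x)]
  [IsContMDiffRiemannianBundle (𝓡 d) ∞ (Rd d) (fun x : M => TangentSpace (𝓡 d) x)]

theorem variationEffect_nonneg {L : TnM d (k + 1) M → ℝ} (hL : Continuous L)
    {μ : Measure (TnM d (k + 1) M)} (hμ : IsHolonomic μ) (hcrit : IsCriticalInHomologyClass L μ)
    {A Λ : Type*} [Fintype A] [Fintype Λ] (i : A → Fin (k + 1))
    {Z : A → ∀ x : M, TangentSpace (𝓡 d) x} (hZ : ∀ a, IsSmoothField (d := d) (Z a))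
    {Y : A → TnM d (k + 1) M → ℝ} (hY : ∀ a, Continuous (Y a))
    {K K₀ : Set (TnM d (k + 1) M)} (hK : IsCompact K) (hK₀ : IsCompact K₀)
    (hYK : ∀ a p, p ∉ K → Y a p = 0)
    {W : Λ → Fin (k + 1) → ∀ x : M, TangentSpace (𝓡 d) x}
    (hW : ∀ l j, IsSmoothField (d := d) (W l j)) {ξ : Λ → TnM d (k + 1) M → ℝ}
    (hξm : ∀ l, Measurable (ξ l)) (hξ : ∀ l, Integrable (ξ l) μ) {c t : ℝ} (ht : 0 < t)
    (hc : c * μ.real K₀ = ∑ l, ∫ p, |ξ l p| ∂μ) (hc0 : 0 ≤ c)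
    (hform : ∀ α : DiffForm d M (k + 1), α.IsClosed →
      variationEffect μ i Z Y W ξ K₀ c t (formFun α.toFun) = 0) :
    0 ≤ variationEffect μ i Z Y W ξ K₀ c t L := by
  have := hμ.prob
  have := t2Space_tnM d (k + 1) M
  let w : A ⊕ (Λ ⊕ (Λ ⊕ Unit)) → TnM d (k + 1) M → ℝ :=
    Sum.elim (fun _ p => K.indicator (fun _ => t⁻¹) p)
      (Sum.elim (fun l p => max (ξ l p) 0) (Sum.elim (fun l p => max (-ξ l p) 0)
        (fun _ p => K₀.indicator (fun _ => c) p)))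
  let T : A ⊕ (Λ ⊕ (Λ ⊕ Unit)) → TnM d (k + 1) M → TnM d (k + 1) M :=
    Sum.elim (fun a p => slotMap (i a) (Z a) p 1 (t * Y a p))
      (Sum.elim (fun l p => tnSection (W l) p.proj)
        (Sum.elim (fun l p => scaleFirst (-1) (tnSection (W l) p.proj))
          (fun _ p => scaleFirst 2 p)))
  let κ : TnM d (k + 1) M → ℝ := fun p =>
    (∑ _a : A, K.indicator (fun _ => t⁻¹) p) + K₀.indicator (fun _ => 2 * c) p
  have hsec : ∀ l, Continuous (tnSection (W l)) := fun l => continuous_tnSection (hW l)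
  have hTA : ∀ a, Continuous fun p => slotMap (i a) (Z a) p 1 (t * Y a p) := fun a =>
    (continuous_slotMap (i a) (hZ a)).comp
      (continuous_id.prodMk (continuous_const.prodMk (continuous_const.mul (hY a))))
  have hT : ∀ s, Continuous (T s) := by
    rintro (a | l | l | u)
    · exact hTA a
    · exact (hsec l).comp continuous_tnProj
    · exact (continuous_scaleFirst (-1)).comp ((hsec l).comp continuous_tnProj)
    · exact continuous_scaleFirst 2
  have hwm : ∀ s, Measurable (w s) := by
    rintro (a | l | l | u)
    · exact measurable_const.indicator hK.measurableSet
    · exact (hξm l).max measurable_const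
    · exact (hξm l).neg.max measurable_const
    · exact measurable_const.indicator hK₀.measurableSet
  have hw0 : ∀ s p, 0 ≤ w s p := by
    rintro (a | l | l | u) p
    · exact indicator_nonneg (fun _ _ => (inv_pos.2 ht).le) p
    · exact le_max_right _ _
    · exact le_max_right _ _
    · exact indicator_nonneg (fun _ _ => hc0) p
  have hw : ∀ s, Integrable (w s) μ := by
    rintro (a | l | l | u)
    · exact (integrable_const _).indicator hK.measurableSet
    · exact (hξ l).pos_part
    · exact (hξ l).neg_part
    · exact (integrable_const _).indicator hK₀.measurableSet
  have hE : ∀ f : TnM d (k + 1) M → ℝ, Continuous f →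
      variationEffect μ i Z Y W ξ K₀ c t f =
        ∑ s, ∫ p, w s p * f (T s p) ∂μ - ∫ p, κ p * f p ∂μ := by
    intro f hf
    have h1 : ∀ a, ∫ p, t⁻¹ * (f (slotMap (i a) (Z a) p 1 (t * Y a p)) - f p) ∂μ =
        ∫ p, w (Sum.inl a) p * f (T (Sum.inl a) p) ∂μ -
          ∫ p, K.indicator (fun _ => t⁻¹) p * f p ∂μ := by
      intro a
      refine Eq.trans ?_ (integral_sub (integrable_indicator_mul hK t⁻¹ (hf.comp (hTA a)))
        (integrable_indicator_mul hK t⁻¹ hf))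
      refine integral_congr_ae (Eventually.of_forall fun p => ?_)
      have hwT : w (Sum.inl a) p * f (T (Sum.inl a) p) =
          K.indicator (fun _ => t⁻¹) p * f (slotMap (i a) (Z a) p 1 (t * Y a p)) := rfl
      simp only [hwT]
      by_cases hp : p ∈ K
      · simp only [indicator_of_mem hp, mul_sub]
      · simp only [indicator_of_notMem hp, hYK a p hp, mul_zero, slotMap_one_zero, sub_self,
          zero_mul]
    have h2 : ∀ l, ∫ p, (max (ξ l p) 0 * f (tnSection (W l) p.proj) +
        max (-ξ l p) 0 * f (scaleFirst (-1) (tnSection (W l) p.proj))) ∂μ =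
        ∫ p, w (Sum.inr (Sum.inl l)) p * f (T (Sum.inr (Sum.inl l)) p) ∂μ +
        ∫ p, w (Sum.inr (Sum.inr (Sum.inl l))) p * f (T (Sum.inr (Sum.inr (Sum.inl l))) p) ∂μ :=
      fun l => integral_add (integrable_max_mul_section (hξ l) (hsec l) hf)
        (integrable_max_mul_section (hξ l).neg ((continuous_scaleFirst (-1)).comp (hsec l)) hf)
    have h3 : c * ∫ p, K₀.indicator (fun _ => 1) p * (f (scaleFirst 2 p) - 2 * f p) ∂μ =
        ∫ p, K₀.indicator (fun _ => c) p * f (scaleFirst 2 p) ∂μ -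
          ∫ p, K₀.indicator (fun _ => 2 * c) p * f p ∂μ := by
      rw [← integral_const_mul]
      refine Eq.trans ?_ (integral_sub
        (integrable_indicator_mul hK₀ c (hf.comp (continuous_scaleFirst 2)))
        (integrable_indicator_mul hK₀ (2 * c) hf))
      refine integral_congr_ae (Eventually.of_forall fun p => ?_)
      by_cases hp : p ∈ K₀
      · simp only [indicator_of_mem hp]
        ring
      · simp only [indicator_of_notMem hp]
        ring
    have h4 : ∫ p, κ p * f p ∂μ = ∑ _a : A, ∫ p, K.indicator (fun _ => t⁻¹) p * f p ∂μ +
        ∫ p, K₀.indicator (fun _ => 2 * c) p * f p ∂μ := by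
      simp only [κ, add_mul, Finset.sum_mul]
      rw [integral_add (integrable_finsetSum _ fun _ _ => integrable_indicator_mul hK t⁻¹ hf)
        (integrable_indicator_mul hK₀ (2 * c) hf),
        integral_finsetSum _ fun _ _ => integrable_indicator_mul hK t⁻¹ hf]
    rw [variationEffect, Finset.sum_congr rfl fun a _ => h1 a, Finset.sum_congr rfl fun l _ => h2 l,
      h3, h4, Finset.sum_sub_distrib, Finset.sum_add_distrib]
    simp only [Fintype.sum_sum_type, Finset.univ_unique, Finset.sum_singleton]
    simp only [w, T, Sum.elim_inl, Sum.elim_inr]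
    ring
  let K' : Set (TnM d (k + 1) M) := (K ∪ K₀) ∪ ((⋃ a, T (Sum.inl a) '' K) ∪
    ((⋃ l, range (tnSection (W l))) ∪ ((⋃ l, range (scaleFirst (-1) ∘ tnSection (W l))) ∪
      scaleFirst 2 '' K₀)))
  have hK' : IsCompact K' := by
    refine (hK.union hK₀).union (IsCompact.union ?_ (IsCompact.union ?_ (IsCompact.union ?_ ?_)))
    · exact isCompact_iUnion fun a => hK.image (hTA a)
    · exact isCompact_iUnion fun l => isCompact_range (hsec l)
    · exact isCompact_iUnion fun l => isCompact_range ((continuous_scaleFirst (-1)).comp (hsec l))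
    · exact hK₀.image (continuous_scaleFirst 2)
  have hwK : ∀ s p, w s p ≠ 0 → T s p ∈ K' := by
    rintro (a | l | l | u) p hp
    · exact Or.inr (Or.inl (mem_iUnion.2 ⟨a, mem_image_of_mem _
        (mem_of_indicator_ne_zero (s := K) (f := fun _ => t⁻¹) hp)⟩))
    · exact Or.inr (Or.inr (Or.inl (mem_iUnion.2 ⟨l, mem_range_self _⟩)))
    · exact Or.inr (Or.inr (Or.inr (Or.inl (mem_iUnion.2 ⟨l, mem_range_self p.proj⟩))))
    · exact Or.inr (Or.inr (Or.inr (Or.inr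
        (mem_image_of_mem _
          (mem_of_indicator_ne_zero (s := K₀) (f := fun _ => c) hp)))))
  have hmass : variationEffect μ i Z Y W ξ K₀ c t (fun _ => 1) = 0 := by
    have h1 : ∀ l p, max (ξ l p) 0 * 1 + max (-ξ l p) 0 * 1 = |ξ l p| := by
      intro l p
      rcases le_total 0 (ξ l p) with h | h
      · rw [max_eq_left h, max_eq_right (neg_nonpos.2 h), abs_of_nonneg h]
        ring
      · rw [max_eq_right h, max_eq_left (neg_nonneg.2 h), abs_of_nonpos h]
        ring
    simp only [variationEffect, sub_self, mul_zero, integral_zero, Finset.sum_const_zero, h1,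
      zero_add]
    rw [← hc, integral_mul_const, integral_indicator_const _ hK₀.measurableSet]
    simp only [smul_eq_mul]
    ring
  have hle := integral_le_sum_transport hL hμ hcrit (κ := κ) (K := K')
    (C := (∑ _a : A, t⁻¹) + 2 * c) ?_ ?_ ?_ ?_ hK' hwm hw0 hw hT hwK ?_ ?_
  · rw [hE L hL]
    linarith
  · exact (Finset.measurable_sum _ fun _ _ => measurable_const.indicator hK.measurableSet).add
      (measurable_const.indicator hK₀.measurableSet)
  · intro p
    exact add_nonneg (Finset.sum_nonneg fun _ _ => indicator_nonneg
      (fun _ _ => (inv_pos.2 ht).le) p) (indicator_nonneg (fun _ _ => by positivity) p)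
  · intro p
    refine add_le_add (Finset.sum_le_sum fun _ _ => ?_) ?_
    · exact indicator_le_self' (fun _ _ => (inv_pos.2 ht).le) p
    · exact indicator_le_self' (fun _ _ => by positivity) p
  · intro p hp
    have h1 : p ∉ K := fun h => hp (Or.inl (Or.inl h))
    have h2 : p ∉ K₀ := fun h => hp (Or.inl (Or.inr h))
    simp only [κ, indicator_of_notMem h1, indicator_of_notMem h2, Finset.sum_const_zero, add_zero]
  · rw [hE _ continuous_const] at hmass
    simp only [mul_one] at hmass
    linarith
  · intro α hα
    have h1 := hform α hα
    rw [hE _ (continuous_formFun α)] at h1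
    linarith

end VariationInequality

section FormOperations

variable {d : ℕ} {M : Type*} [TopologicalSpace M] [ChartedSpace (Rd d) M]
  [IsManifold (𝓡 d) ∞ M]

theorem DiffForm.IsClosed.extDeriv_eq_zero {k : ℕ} {α : DiffForm d M k} (hα : α.IsClosed) (c : M) :
    extDeriv (formInChart α.toFun c) (extChartAt (𝓡 d) c c) = 0 := by
  rw [← α.formInChart_extD c (mem_extChartAt_target c)]
  ext v
  have h : formInChart α.extD c (extChartAt (𝓡 d) c c) v =
      α.extD ((extChartAt (𝓡 d) c).symm (extChartAt (𝓡 d) c c)) fun i =>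
        mfderiv 𝓘(ℝ, Rd d) (𝓡 d) (extChartAt (𝓡 d) c).symm (extChartAt (𝓡 d) c c) (v i) := rfl
  rw [h, hα]
  rfl

omit [IsManifold (𝓡 d) ∞ M] in
theorem DiffForm.differentiableAt {k : ℕ} (α : DiffForm d M k) (c : M) :
    DifferentiableAt ℝ (formInChart α.toFun c) (extChartAt (𝓡 d) c c) :=
  ((α.smooth c).contDiffAt (extChartAt_target_mem_nhds c)).differentiableAt (by simp)

/-- Linear combinations of forms. -/
def DiffForm.lin {k : ℕ} (a b : ℝ) (α β : DiffForm d M k) : DiffForm d M k where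
  toFun x := a • α.toFun x + b • β.toFun x
  smooth c := (contDiffOn_const (c := a).smul (α.smooth c)).add
    (contDiffOn_const (c := b).smul (β.smooth c))

theorem DiffForm.IsClosed.lin {k : ℕ} {α β : DiffForm d M k} (a b : ℝ) (hα : α.IsClosed)
    (hβ : β.IsClosed) : (DiffForm.lin a b α β).IsClosed := by
  refine DiffForm.isClosed_of_extDeriv fun c => ?_
  have h : formInChart (DiffForm.lin a b α β).toFun c =
      a • formInChart α.toFun c + b • formInChart β.toFun c := rfl
  rw [h, extDeriv_add ((α.differentiableAt c).const_smul a) ((β.differentiableAt c).const_smul b),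
    extDeriv_smul, extDeriv_smul, hα.extDeriv_eq_zero, hβ.extDeriv_eq_zero, smul_zero, smul_zero,
    add_zero]

omit [IsManifold (𝓡 d) ∞ M] in
theorem slotDeriv_formFun_lin {n : ℕ} (i : Fin n) (Z : ∀ x : M, TangentSpace (𝓡 d) x) (a b : ℝ)
    (α β : DiffForm d M n) (p : TnM d n M) :
    slotDeriv i Z (formFun (DiffForm.lin a b α β).toFun) p 0 =
      a * slotDeriv i Z (formFun α.toFun) p 0 + b * slotDeriv i Z (formFun β.toFun) p 0 := by
  rw [slotDeriv_formFun, slotDeriv_formFun, slotDeriv_formFun]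
  rfl

end FormOperations

section VariationBound

variable {d k : ℕ} {M : Type*} [TopologicalSpace M] [T2Space M] [CompactSpace M]
  [ChartedSpace (Rd d) M] [IsManifold (𝓡 d) ∞ M]
  [RiemannianBundle (fun x : M => TangentSpace (𝓡 d) x)]
  [IsContMDiffRiemannianBundle (𝓡 d) ∞ (Rd d) (fun x : M => TangentSpace (𝓡 d) x)]

/-- Infinitesimal vertical displacements `Y`, together with masses `ξ` on sections that compensate
their effect on closed forms, cannot decrease the action by more than a multiple of the mass. -/
theorem exists_variation_bound {L : TnM d (k + 1) M → ℝ}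
    (hL : ContMDiff (tnModel d (k + 1)) 𝓘(ℝ, ℝ) ∞ L)
    {μ : Measure (TnM d (k + 1) M)} (hμ : IsHolonomic μ) (hcrit : IsCriticalInHomologyClass L μ)
    {A Λ : Type*} [Fintype A] [Fintype Λ] (i : A → Fin (k + 1))
    {Z : A → ∀ x : M, TangentSpace (𝓡 d) x} (hZ : ∀ a, IsSmoothField (d := d) (Z a))
    {W : Λ → Fin (k + 1) → ∀ x : M, TangentSpace (𝓡 d) x}
    (hW : ∀ l j, IsSmoothField (d := d) (W l j)) :
    ∃ B : ℝ, 0 ≤ B ∧ ∀ (Y : A → TnM d (k + 1) M → ℝ) (K : Set (TnM d (k + 1) M))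
      (ξ : Λ → TnM d (k + 1) M → ℝ), (∀ a, Continuous (Y a)) → IsCompact K →
      (∀ a p, p ∉ K → Y a p = 0) → (∀ l, Measurable (ξ l)) → (∀ l, Integrable (ξ l) μ) →
      (∀ α : DiffForm d M (k + 1), α.IsClosed →
        ∑ a, ∫ p, Y a p * slotDeriv (i a) (Z a) (formFun α.toFun) p 0 ∂μ +
          ∑ l, ∫ p, ξ l p * formFun α.toFun (tnSection (W l) p.proj) ∂μ = 0) →
      0 ≤ ∑ a, ∫ p, Y a p * slotDeriv (i a) (Z a) L p 0 ∂μ + B * ∑ l, ∫ p, |ξ l p| ∂μ := by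
  have := hμ.prob
  have := regular_of_isFiniteMeasure_tnM μ
  obtain ⟨K₀, -, hK₀, hμK₀⟩ := isOpen_univ.exists_lt_isCompact (μ := μ) (r := 0) (by simp)
  have hμK₀' : 0 < μ.real K₀ := ENNReal.toReal_pos hμK₀.ne' (measure_ne_top _ _)
  have hsec : ∀ l, Continuous (tnSection (W l)) := fun l => continuous_tnSection (hW l)
  have hb : ∀ l, ∃ b : ℝ, ∀ x : M, ‖L (tnSection (W l) x)‖ ≤ b ∧
      ‖L (scaleFirst (-1) (tnSection (W l) x))‖ ≤ b := by
    intro l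
    obtain ⟨b₁, hb₁⟩ := isCompact_univ.exists_bound_of_continuousOn
      (hL.continuous.comp (hsec l)).continuousOn
    obtain ⟨b₂, hb₂⟩ := isCompact_univ.exists_bound_of_continuousOn
      (hL.continuous.comp ((continuous_scaleFirst (-1)).comp (hsec l))).continuousOn
    exact ⟨max b₁ b₂, fun x => ⟨(hb₁ x trivial).trans (le_max_left _ _),
      (hb₂ x trivial).trans (le_max_right _ _)⟩⟩
  choose b hb using hb
  set D := ∫ p, K₀.indicator (fun _ => 1) p * (L (scaleFirst 2 p) - 2 * L p) ∂μ with hD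
  have hB₁ : ∀ l, b l ≤ ∑ l, |b l| := fun l => (le_abs_self _).trans
    (Finset.single_le_sum (f := fun l => |b l|) (fun _ _ => abs_nonneg _) (Finset.mem_univ l))
  refine ⟨∑ l, |b l| + |D| / μ.real K₀, by positivity, ?_⟩
  intro Y K ξ hY hK hYK hξm hξ hform
  set m := ∑ l, ∫ p, |ξ l p| ∂μ with hm
  have hm0 : 0 ≤ m := Finset.sum_nonneg fun l _ => integral_nonneg fun p => abs_nonneg _
  let c := m / μ.real K₀
  have hc : c * μ.real K₀ = m := div_mul_cancel₀ _ hμK₀'.ne'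
  have hc0 : 0 ≤ c := div_nonneg hm0 hμK₀'.le
  have hsplit : ∀ l p, max (ξ l p) 0 - max (-ξ l p) 0 = ξ l p := by
    intro l p
    rcases le_total 0 (ξ l p) with h | h
    · rw [max_eq_left h, max_eq_right (neg_nonpos.2 h), sub_zero]
    · rw [max_eq_right h, max_eq_left (neg_nonneg.2 h), zero_sub, neg_neg]
  have habs : ∀ l p, max (ξ l p) 0 + max (-ξ l p) 0 = |ξ l p| := by
    intro l p
    rcases le_total 0 (ξ l p) with h | h
    · rw [max_eq_left h, max_eq_right (neg_nonpos.2 h), add_zero, abs_of_nonneg h]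
    · rw [max_eq_right h, max_eq_left (neg_nonneg.2 h), zero_add, abs_of_nonpos h]
  have hvar : ∀ t : ℝ, 0 < t → 0 ≤ variationEffect μ i Z Y W ξ K₀ c t L := by
    intro t ht
    refine variationEffect_nonneg hL.continuous hμ hcrit i hZ hY hK hK₀ hYK hW hξm hξ ht hc hc0
      fun α hα => ?_
    have h1 : ∀ a p, t⁻¹ * (formFun α.toFun (slotMap (i a) (Z a) p 1 (t * Y a p)) -
        formFun α.toFun p) = Y a p * slotDeriv (i a) (Z a) (formFun α.toFun) p 0 := by
      intro a p
      rw [formFun_slotMap, slotDeriv_formFun]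
      field_simp
      ring
    have h2 : ∀ l p, max (ξ l p) 0 * formFun α.toFun (tnSection (W l) p.proj) +
        max (-ξ l p) 0 * formFun α.toFun (scaleFirst (-1) (tnSection (W l) p.proj)) =
        ξ l p * formFun α.toFun (tnSection (W l) p.proj) := by
      intro l p
      rw [formFun_scaleFirst]
      conv_rhs => rw [← hsplit l p]
      ring
    refine Eq.trans ?_ (hform α hα)
    simp only [variationEffect, h1, h2]
    simp only [formFun_scaleFirst, sub_self, mul_zero, integral_zero, add_zero]
  have hsnd : ∑ l, ∫ p, (max (ξ l p) 0 * L (tnSection (W l) p.proj) +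
      max (-ξ l p) 0 * L (scaleFirst (-1) (tnSection (W l) p.proj))) ∂μ ≤ (∑ l, |b l|) * m := by
    rw [hm, Finset.mul_sum]
    refine Finset.sum_le_sum fun l _ => ?_
    rw [← integral_const_mul]
    have hbd : ∀ p, ‖max (ξ l p) 0 * L (tnSection (W l) p.proj) +
        max (-ξ l p) 0 * L (scaleFirst (-1) (tnSection (W l) p.proj))‖ ≤
        (∑ l, |b l|) * |ξ l p| := by
      intro p
      rw [← habs l p, mul_add]
      refine (norm_add_le _ _).trans (add_le_add ?_ ?_)
      · rw [norm_mul, Real.norm_of_nonneg (le_max_right _ _), mul_comm]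
        exact mul_le_mul_of_nonneg_right ((hb l p.proj).1.trans (hB₁ l)) (le_max_right _ _)
      · rw [norm_mul, Real.norm_of_nonneg (le_max_right _ _), mul_comm]
        exact mul_le_mul_of_nonneg_right ((hb l p.proj).2.trans (hB₁ l)) (le_max_right _ _)
    exact (le_abs_self _).trans
      (norm_integral_le_of_norm_le ((hξ l).abs.const_mul _) (Eventually.of_forall hbd))
  have hthd : c * D ≤ |D| / μ.real K₀ * m := by
    have : |D| / μ.real K₀ * m = c * |D| := by
      simp only [c]
      ring
    rw [this]
    exact mul_le_mul_of_nonneg_left (le_abs_self D) hc0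
  let t : ℕ → ℝ := fun m => 1 / ((m : ℝ) + 1)
  have ht0 : ∀ m, 0 < t m := fun m => Nat.one_div_pos_of_nat
  have ht1 : ∀ m, t m ≤ 1 := fun m => by
    rw [div_le_one (by positivity)]
    have : (0 : ℝ) ≤ m := m.cast_nonneg
    linarith
  have hlim : Tendsto (fun n => ∑ a, ∫ p, (t n)⁻¹ *
      (L (slotMap (i a) (Z a) p 1 (t n * Y a p)) - L p) ∂μ) atTop
      (𝓝 (∑ a, ∫ p, Y a p * slotDeriv (i a) (Z a) L p 0 ∂μ)) :=
    tendsto_finsetSum _ fun a _ => tendsto_integral_slotMap (i a) (hZ a) hL (hY a) hK (hYK a)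
      ht0 ht1 tendsto_one_div_add_atTop_nhds_zero_nat
  have hge : -((∑ l, |b l| + |D| / μ.real K₀) * m) ≤
      ∑ a, ∫ p, Y a p * slotDeriv (i a) (Z a) L p 0 ∂μ := by
    refine ge_of_tendsto hlim (Eventually.of_forall fun n => ?_)
    have h1 := hvar (t n) (ht0 n)
    rw [variationEffect, ← hD] at h1
    linarith
  linarith

end VariationBound

section L2Approximation

variable {X E : Type*} [MeasurableSpace X] {μ : Measure X} [NormedAddCommGroup E]
  [InnerProductSpace ℝ E]

theorem inner_toLp {f g : X → E} (hf : MemLp f 2 μ) (hg : MemLp g 2 μ) :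
    inner ℝ (hf.toLp f) (hg.toLp g) = ∫ p, inner ℝ (f p) (g p) ∂μ := by
  rw [L2.inner_def]
  refine integral_congr_ae ?_
  filter_upwards [hf.coeFn_toLp, hg.coeFn_toLp] with p h1 h2
  rw [h1, h2]

theorem integrable_inner_of_memLp {f g : X → E} (hf : MemLp f 2 μ) (hg : MemLp g 2 μ) :
    Integrable (fun p => (inner ℝ (f p) (g p) : ℝ)) μ := by
  refine (L2.integrable_inner (𝕜 := ℝ) (hf.toLp f) (hg.toLp g)).congr ?_
  filter_upwards [hf.coeFn_toLp, hg.coeFn_toLp] with p h1 h2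
  rw [h1, h2]

theorem integral_abs_inner_le {f g : X → E} (hf : MemLp f 2 μ) (hg : MemLp g 2 μ) {ε : ℝ}
    (hε : 0 < ε) (h : eLpNorm f 2 μ ≤ ENNReal.ofReal ε) :
    ∫ p, |inner ℝ (f p) (g p)| ∂μ ≤ ε * (1 + ∫ p, ‖g p‖ ^ 2 ∂μ) := by
  have hsq : ∫ p, ‖f p‖ ^ 2 ∂μ ≤ ε ^ 2 := by
    have h1 : ‖hf.toLp f‖ ≤ ε := by
      rw [Lp.norm_toLp]
      exact ENNReal.toReal_le_of_le_ofReal hε.le h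
    have h2 : ‖hf.toLp f‖ ^ 2 = ∫ p, ‖f p‖ ^ 2 ∂μ := by
      rw [← real_inner_self_eq_norm_sq, inner_toLp]
      simp only [real_inner_self_eq_norm_sq]
    rw [← h2]
    exact pow_le_pow_left₀ (norm_nonneg _) h1 2
  have hfi := (memLp_two_iff_integrable_sq_norm hf.1).1 hf
  have hgi := (memLp_two_iff_integrable_sq_norm hg.1).1 hg
  calc ∫ p, |inner ℝ (f p) (g p)| ∂μ ≤ ∫ p, (ε⁻¹ * ‖f p‖ ^ 2 + ε * ‖g p‖ ^ 2) ∂μ := by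
        refine integral_mono (integrable_inner_of_memLp hf hg).abs
          ((hfi.const_mul _).add (hgi.const_mul _)) fun p => ?_
        refine (abs_real_inner_le_norm _ _).trans ?_
        have h3 : ε⁻¹ * ‖f p‖ ^ 2 + ε * ‖g p‖ ^ 2 - ‖f p‖ * ‖g p‖ =
            ε⁻¹ * ((‖f p‖ - ε / 2 * ‖g p‖) ^ 2 + 3 / 4 * (ε * ‖g p‖) ^ 2) := by
          field_simp
          ring
        have h4 : 0 ≤ ε⁻¹ * ((‖f p‖ - ε / 2 * ‖g p‖) ^ 2 + 3 / 4 * (ε * ‖g p‖) ^ 2) := by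
          positivity
        linarith
    _ = ε⁻¹ * ∫ p, ‖f p‖ ^ 2 ∂μ + ε * ∫ p, ‖g p‖ ^ 2 ∂μ := by
        rw [integral_add (hfi.const_mul _) (hgi.const_mul _), integral_const_mul,
          integral_const_mul]
    _ ≤ ε⁻¹ * ε ^ 2 + ε * ∫ p, ‖g p‖ ^ 2 ∂μ := by gcongr
    _ = ε * (1 + ∫ p, ‖g p‖ ^ 2 ∂μ) := by
        field_simp

/-- If every `F` orthogonal to the functions `G α` has, up to the effect of a compactly supported
approximation `Y`, a nonnegative pairing with `g`, then `g` is a limit of functions `G α`. -/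
theorem exists_seq_tendsto_eLpNorm_sub [CompleteSpace E] [TopologicalSpace X] [T2Space X] [NormalSpace X]
    [BorelSpace X] [LocallyCompactSpace X] [μ.Regular] {S Λ : Type*} [Nonempty S]
    [Fintype Λ] {G : S → X → E} (hG : ∀ s, MemLp (G s) 2 μ)
    (hlin : ∀ (a b : ℝ) (s t : S), ∃ r, ∀ p, G r p = a • G s p + b • G t p)
    {g : X → E} (hg : MemLp g 2 μ) {h : Λ → X → E} (hh : ∀ l, MemLp (h l) 2 μ) {B : ℝ}
    (hB : 0 ≤ B) (H : ∀ F Y : X → E, StronglyMeasurable F → MemLp F 2 μ →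
      (∀ s, ∫ p, inner ℝ (F p) (G s p) ∂μ = 0) → Continuous Y → HasCompactSupport Y →
      0 ≤ ∫ p, inner ℝ (Y p) (g p) ∂μ + B * ∑ l, ∫ p, |inner ℝ (F p - Y p) (h l p)| ∂μ) :
    ∃ s : ℕ → S, Tendsto (fun m => eLpNorm (g - G (s m)) 2 μ) atTop (𝓝 0) := by
  let V : Submodule ℝ (Lp E 2 μ) :=
    { carrier := range fun s => (hG s).toLp (G s)
      add_mem' := by
        rintro _ _ ⟨s, rfl⟩ ⟨t, rfl⟩
        obtain ⟨r, hr⟩ := hlin 1 1 s t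
        refine ⟨r, ?_⟩
        simp only [← MemLp.toLp_add]
        refine MemLp.toLp_congr _ _ (Eventually.of_forall fun p => ?_)
        rw [hr, one_smul, one_smul, Pi.add_apply]
      zero_mem' := by
        obtain ⟨s⟩ := ‹Nonempty S›
        obtain ⟨r, hr⟩ := hlin 0 0 s s
        refine ⟨r, ?_⟩
        have h0 : MemLp (0 : X → E) 2 μ := MemLp.zero
        rw [← MemLp.toLp_zero h0]
        refine MemLp.toLp_congr _ _ (Eventually.of_forall fun p => ?_)
        rw [hr, zero_smul, zero_add]
        rfl
      smul_mem' := by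
        rintro c _ ⟨s, rfl⟩
        obtain ⟨r, hr⟩ := hlin c 0 s s
        refine ⟨r, ?_⟩
        simp only [← MemLp.toLp_const_smul]
        refine MemLp.toLp_congr _ _ (Eventually.of_forall fun p => ?_)
        rw [hr, zero_smul, add_zero, Pi.smul_apply] }
  let U := V.topologicalClosure
  have hUc : IsClosed (U : Set (Lp E 2 μ)) := V.isClosed_topologicalClosure
  have : CompleteSpace U := hUc.completeSpace_coe
  have hmem : hg.toLp g ∈ U := by
    by_contra hgU
    set x := hg.toLp g with hx
    let z : Lp E 2 μ := U.starProjection x - x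
    have hz : z ≠ 0 := fun h0 => hgU (U.starProjection_eq_self_iff.1 (sub_eq_zero.1 h0))
    have horth : ∀ u ∈ U, inner ℝ z u = 0 := by
      intro u hu
      have h1 := U.starProjection_inner_eq_zero x u hu
      have h2 : z = -(x - U.starProjection x) := (neg_sub _ _).symm
      rw [h2, inner_neg_left, h1, neg_zero]
    have hzx : inner ℝ z x = -‖z‖ ^ 2 := by
      have h1 : x = U.starProjection x - z := (sub_sub_cancel _ _).symm
      conv_lhs => rw [h1]
      rw [inner_sub_right, horth _ (U.starProjection_apply_mem x), real_inner_self_eq_norm_sq,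
        zero_sub]
    have hzF : MemLp (z : X → E) 2 μ := Lp.memLp z
    have hzL : hzF.toLp z = z := Lp.toLp_coeFn z hzF
    have hFG : ∀ s, ∫ p, inner ℝ ((z : X → E) p) (G s p) ∂μ = 0 := by
      intro s
      rw [← inner_toLp hzF (hG s), hzL]
      exact horth _ (V.le_topologicalClosure ⟨s, rfl⟩)
    have hFg : ∫ p, inner ℝ ((z : X → E) p) (g p) ∂μ = -‖z‖ ^ 2 := by
      rw [← inner_toLp hzF hg, hzL, ← hx, hzx]
    set Q := (1 + ∫ p, ‖g p‖ ^ 2 ∂μ) + B * ∑ l, (1 + ∫ p, ‖h l p‖ ^ 2 ∂μ) with hQ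
    have hQ0 : 0 < Q := by
      have h1 : 0 ≤ ∫ p, ‖g p‖ ^ 2 ∂μ := integral_nonneg fun p => sq_nonneg _
      have h2 : 0 ≤ ∑ l, (1 + ∫ p, ‖h l p‖ ^ 2 ∂μ) := Finset.sum_nonneg fun l _ =>
        add_nonneg zero_le_one (integral_nonneg fun p => sq_nonneg _)
      have h3 := mul_nonneg hB h2
      linarith
    have hkey : ∀ ε : ℝ, 0 < ε → ‖z‖ ^ 2 ≤ ε * Q := by
      intro ε hε
      obtain ⟨Y, hYs, hYε, hYc, hY⟩ := hzF.exists_hasCompactSupport_eLpNorm_sub_le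
        (by simp) (ε := ENNReal.ofReal ε) (by simpa using hε)
      have hd : MemLp (⇑z - Y) 2 μ := hzF.sub hY
      have h1 := H z Y (Lp.stronglyMeasurable z) hzF hFG hYc hYs
      have h2 : ∫ p, inner ℝ (Y p) (g p) ∂μ ≤ -‖z‖ ^ 2 + ε * (1 + ∫ p, ‖g p‖ ^ 2 ∂μ) := by
        have h3 : ∫ p, inner ℝ (Y p) (g p) ∂μ = -‖z‖ ^ 2 -
            ∫ p, inner ℝ ((⇑z - Y) p) (g p) ∂μ := by
          rw [← hFg, ← integral_sub (integrable_inner_of_memLp hzF hg)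
            (integrable_inner_of_memLp hd hg)]
          refine integral_congr_ae (Eventually.of_forall fun p => ?_)
          simp only [Pi.sub_apply, inner_sub_left, sub_sub_cancel]
        have h4 : -∫ p, inner ℝ ((⇑z - Y) p) (g p) ∂μ ≤
            ∫ p, |inner ℝ ((⇑z - Y) p) (g p)| ∂μ :=
          (neg_le_abs _).trans abs_integral_le_integral_abs
        have h5 := integral_abs_inner_le hd hg hε hYε
        linarith
      have h6 : ∑ l, ∫ p, |inner ℝ ((z : X → E) p - Y p) (h l p)| ∂μ ≤
          ε * ∑ l, (1 + ∫ p, ‖h l p‖ ^ 2 ∂μ) := by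
        rw [Finset.mul_sum]
        exact Finset.sum_le_sum fun l _ => integral_abs_inner_le hd (hh l) hε hYε
      have h7 := mul_le_mul_of_nonneg_left h6 hB
      have h8 : ε * Q = ε * (1 + ∫ p, ‖g p‖ ^ 2 ∂μ) +
          B * (ε * ∑ l, (1 + ∫ p, ‖h l p‖ ^ 2 ∂μ)) := by
        rw [hQ]
        ring
      linarith
    have hz0 : 0 < ‖z‖ ^ 2 := pow_pos (norm_pos_iff.2 hz) 2
    have h9 := hkey (‖z‖ ^ 2 / (2 * Q)) (by positivity)
    have h10 : ‖z‖ ^ 2 / (2 * Q) * Q = ‖z‖ ^ 2 / 2 := by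
      field_simp
    linarith
  have hcl : hg.toLp g ∈ closure (V : Set (Lp E 2 μ)) := hmem
  obtain ⟨x, hxV, hxlim⟩ := mem_closure_iff_seq_limit.1 hcl
  choose s hs using hxV
  refine ⟨s, ?_⟩
  have h1 := tendsto_iff_edist_tendsto_0.1 hxlim
  refine h1.congr fun m => ?_
  rw [← hs m, edist_comm, Lp.edist_toLp_toLp]

end L2Approximation

section FrameGradient

variable {d n : ℕ} {M : Type*} [TopologicalSpace M] [ChartedSpace (Rd d) M]
  {A : Type*} [Fintype A]

/-- The vertical derivatives of `f` at `p`, in the slots `i a` along the fields `Z a`. -/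
def slotGrad (i : A → Fin n) (Z : A → ∀ x : M, TangentSpace (𝓡 d) x) (f : TnM d n M → ℝ)
    (p : TnM d n M) : EuclideanSpace ℝ A :=
  WithLp.toLp 2 fun a => slotDeriv (i a) (Z a) f p 0

theorem inner_slotGrad (u : EuclideanSpace ℝ A) (i : A → Fin n)
    (Z : A → ∀ x : M, TangentSpace (𝓡 d) x) (f : TnM d n M → ℝ) (p : TnM d n M) :
    inner ℝ u (slotGrad i Z f p) = ∑ a, u a * slotDeriv (i a) (Z a) f p 0 := by
  rw [PiLp.inner_apply]
  exact Finset.sum_congr rfl fun a _ => mul_comm _ _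

theorem lintegral_ofReal_norm_sq {X E : Type*} [MeasurableSpace X] {μ : Measure X}
    [NormedAddCommGroup E] (f : X → E) :
    ∫⁻ p, ENNReal.ofReal (‖f p‖ ^ 2) ∂μ = eLpNorm f 2 μ ^ 2 := by
  have h := eLpNorm_nnreal_pow_eq_lintegral (f := f) (μ := μ) (p := 2) (by simp)
  simp only [NNReal.coe_ofNat, ENNReal.rpow_ofNat] at h
  refine Eq.trans (lintegral_congr fun p => ?_) h.symm
  rw [ENNReal.ofReal_pow (norm_nonneg _), ofReal_norm]

variable [IsManifold (𝓡 d) ∞ M] [RiemannianBundle (fun x : M => TangentSpace (𝓡 d) x)]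

theorem memLp_slotGrad {μ : Measure (TnM d n M)} (i : A → Fin n)
    {Z : A → ∀ x : M, TangentSpace (𝓡 d) x} (hZ : ∀ a, ∃ C : ℝ, ∀ x, ‖Z a x‖ ≤ C)
    {f : TnM d n M → ℝ} (hc : Continuous (slotGrad i Z f))
    (hf : ∀ a p, inner ℝ (vertGrad f p (i a)) (Z a p.proj) = slotDeriv (i a) (Z a) f p 0)
    (hfin : sqNormH μ (vertGrad f) < ⊤) : MemLp (slotGrad i Z f) 2 μ := by
  choose C hC using hZ
  refine ⟨hc.measurable.aestronglyMeasurable, ?_⟩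
  have h : eLpNorm (slotGrad i Z f) 2 μ ^ 2 ≤
      ENNReal.ofReal (∑ a, C a ^ 2) * sqNormH μ (vertGrad f) := by
    rw [← lintegral_ofReal_norm_sq, sqNormH, ← lintegral_const_mul' _ _ ENNReal.ofReal_ne_top]
    refine lintegral_mono fun p => ?_
    rw [← ENNReal.ofReal_mul (Finset.sum_nonneg fun a _ => sq_nonneg _)]
    refine ENNReal.ofReal_le_ofReal ?_
    rw [EuclideanSpace.real_norm_sq_eq, Finset.sum_mul]
    refine Finset.sum_le_sum fun a _ => ?_
    have h1 : slotGrad i Z f p a = inner ℝ (vertGrad f p (i a)) (Z a p.proj) := (hf a p).symm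
    rw [h1, ← sq_abs]
    have h2 : |inner ℝ (vertGrad f p (i a)) (Z a p.proj)| ≤ ‖vertGrad f p (i a)‖ * C a :=
      (abs_real_inner_le_norm _ _).trans
        (mul_le_mul_of_nonneg_left (hC a p.proj) (norm_nonneg _))
    refine (pow_le_pow_left₀ (abs_nonneg _) h2 2).trans ?_
    rw [mul_pow, mul_comm]
    exact mul_le_mul_of_nonneg_left (Finset.single_le_sum
      (f := fun j => ‖vertGrad f p j‖ ^ 2) (fun _ _ => sq_nonneg _) (Finset.mem_univ (i a)))
      (sq_nonneg _)
  have h3 := h.trans_lt (ENNReal.mul_lt_top ENNReal.ofReal_lt_top hfin)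
  exact (ENNReal.pow_lt_top_iff.1 h3).resolve_right two_ne_zero

/-- Slots and fields of a frame, in one index. -/
abbrev FormFrame.slot (Fr : FormFrame d n M) (a : Fin n × (Fin Fr.N × Fin d)) : Fin n := a.1

/-- Slots and fields of a frame, in one index. -/
abbrev FormFrame.field (Fr : FormFrame d n M) (a : Fin n × (Fin Fr.N × Fin d)) :
    ∀ x : M, TangentSpace (𝓡 d) x := Fr.Z a.2

theorem sqNormH_sub_le {μ : Measure (TnM d n M)} (Fr : FormFrame d n M)
    {f g : TnM d n M → ℝ}
    (hf : ∀ a p, inner ℝ (vertGrad f p (Fr.slot a)) (Fr.field a p.proj) =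
      slotDeriv (Fr.slot a) (Fr.field a) f p 0)
    (hg : ∀ a p, inner ℝ (vertGrad g p (Fr.slot a)) (Fr.field a p.proj) =
      slotDeriv (Fr.slot a) (Fr.field a) g p 0) :
    sqNormH μ (fun p => vertGrad f p - vertGrad g p) ≤ ENNReal.ofReal |Fr.C| *
      eLpNorm (slotGrad Fr.slot Fr.field f - slotGrad Fr.slot Fr.field g) 2 μ ^ 2 := by
  rw [← lintegral_ofReal_norm_sq, sqNormH, ← lintegral_const_mul' _ _ ENNReal.ofReal_ne_top]
  refine lintegral_mono fun p => ?_
  rw [← ENNReal.ofReal_mul (abs_nonneg _)]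
  refine ENNReal.ofReal_le_ofReal ?_
  rw [EuclideanSpace.real_norm_sq_eq, Fintype.sum_prod_type, Finset.mul_sum]
  refine Finset.sum_le_sum fun i _ => ?_
  refine (Fr.sq_norm_le p.proj (vertGrad f p i - vertGrad g p i)).trans ?_
  refine (mul_le_mul_of_nonneg_right (le_abs_self _)
    (Finset.sum_nonneg fun _ _ => sq_nonneg _)).trans (le_of_eq ?_)
  congr 1
  refine Finset.sum_congr rfl fun j _ => ?_
  rw [inner_sub_left, hf (i, j) p, hg (i, j) p]
  rfl

/-- Vertical derivatives of a form, recovered from its values on the fields of a frame. -/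
theorem FormFrame.sum_mul_form (Fr : FormFrame d n M) (α : DiffForm d M n) (p : TnM d n M)
    (u : EuclideanSpace ℝ (Fin n × (Fin Fr.N × Fin d))) :
    ∑ l : Fin Fr.N × (Fin n → Fin d), (Fr.χ l.1 p.proj *
      inner ℝ u (slotGrad Fr.slot Fr.field (formFun (Fr.form l.1 l.2).toFun) p)) *
        formFun α.toFun (tnSection (fun j => Fr.Z (l.1, l.2 j)) p.proj) =
      inner ℝ u (slotGrad Fr.slot Fr.field (formFun α.toFun) p) := by
  simp only [inner_slotGrad]
  have h : ∀ a, slotDeriv (Fr.slot a) (Fr.field a) (formFun α.toFun) p 0 =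
      ∑ l : Fin Fr.N × (Fin n → Fin d), Fr.χ l.1 p.proj *
        (slotDeriv (Fr.slot a) (Fr.field a) (formFun (Fr.form l.1 l.2).toFun) p 0 *
        formFun α.toFun (tnSection (fun j => Fr.Z (l.1, l.2 j)) p.proj)) := by
    intro a
    rw [slotDeriv_formFun, Fr.expansion, Fintype.sum_prod_type]
    simp only [Finset.mul_sum, slotDeriv_formFun]
    rfl
  simp only [h, Finset.mul_sum, Finset.sum_mul]
  rw [Finset.sum_comm]
  refine Finset.sum_congr rfl fun l _ => Finset.sum_congr rfl fun a _ => ?_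
  ring

end FrameGradient

section Main

variable {d : ℕ} {M : Type*} [TopologicalSpace M] [ChartedSpace (Rd d) M]
  [IsManifold (𝓡 d) ∞ M]

theorem DiffForm.exists_isClosed (d k : ℕ) (M : Type*) [TopologicalSpace M]
    [ChartedSpace (Rd d) M] [IsManifold (𝓡 d) ∞ M] : ∃ α : DiffForm d M k, α.IsClosed := by
  have h : ∀ c : M, formInChart (k := k) (d := d) (fun x : M => 0) c = fun _ => 0 := fun c => by
    funext y
    ext v
    rfl
  refine ⟨⟨fun x => 0, fun c => ?_⟩, DiffForm.isClosed_of_extDeriv fun c => ?_⟩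
  · rw [h]
    exact contDiffOn_const
  · rw [h, extDeriv, fderiv_fun_const]
    exact map_zero (ContinuousAlternatingMap.alternatizeUncurryFinCLM ℝ (Rd d) ℝ)

theorem continuous_slotGrad {n : ℕ} {A : Type*} [Fintype A] {i : A → Fin n}
    {Z : A → ∀ x : M, TangentSpace (𝓡 d) x} {f : TnM d n M → ℝ}
    (h : ∀ a, Continuous fun p : TnM d n M => slotDeriv (i a) (Z a) f p 0) :
    Continuous (slotGrad i Z f) :=
  (PiLp.continuous_toLp 2 _).comp (continuous_pi h)

end Main

end

theorem mainTheorem10 {d k : ℕ} (hkd : k + 1 ≤ d)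
    {M : Type*} [TopologicalSpace M] [T2Space M] [CompactSpace M]
    [ChartedSpace (Rd d) M] [IsManifold (𝓡 d) ∞ M]
    [RiemannianBundle (fun x : M => TangentSpace (𝓡 d) x)]
    [IsContMDiffRiemannianBundle (𝓡 d) ∞ (Rd d) (fun x : M => TangentSpace (𝓡 d) x)]
    (L : TnM d (k + 1) M → ℝ) (hL : ContMDiff (tnModel d (k + 1)) 𝓘(ℝ, ℝ) ∞ L)
    (μ : Measure (TnM d (k + 1) M)) (hμ : IsHolonomic μ)
    (hcrit : IsCriticalInHomologyClass L μ)
    (hLfin : sqNormH μ (vertGrad L) < ⊤)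
    (hform : ∀ α : DiffForm d M (k + 1), α.IsClosed →
      sqNormH μ (vertGrad (formFun α.toFun)) < ⊤) :
    ∃ α : ℕ → DiffForm d M (k + 1), (∀ i, (α i).IsClosed) ∧
      Tendsto (fun i => sqNormH μ (fun p => vertGrad L p - vertGrad (formFun (α i).toFun) p))
        atTop (𝓝 0) := by
  have := hμ.prob
  have := regular_of_isFiniteMeasure_tnM μ
  have := t2Space_tnM d (k + 1) M
  have := sigmaCompactSpace_tnM d (k + 1) M
  have := locallyCompactSpace_tnM d (k + 1) M
  have := Manifold.metrizableSpace (tnModel d (k + 1)) (TnM d (k + 1) M)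
  obtain ⟨Fr⟩ := nonempty_formFrame (d := d) (n := k + 1) (M := M)
  have hZ : ∀ a, IsSmoothField (d := d) (Fr.field a) := fun a => Fr.smooth a.2
  have hZb : ∀ a, ∃ C : ℝ, ∀ x, ‖Fr.field a x‖ ≤ C := fun a => exists_norm_field_le (hZ a)
  let S := {α : DiffForm d M (k + 1) // α.IsClosed}
  have : Nonempty S := by
    obtain ⟨α, hα⟩ := DiffForm.exists_isClosed d (k + 1) M
    exact ⟨⟨α, hα⟩⟩
  let G : S → TnM d (k + 1) M → EuclideanSpace ℝ (Fin (k + 1) × (Fin Fr.N × Fin d)) :=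
    fun α => slotGrad Fr.slot Fr.field (formFun α.1.toFun)
  have hGc : ∀ α, Continuous (G α) := fun α =>
    continuous_slotGrad fun a => continuous_slotDeriv_formFun _ (hZ a) α.1
  have hgc : Continuous (slotGrad Fr.slot Fr.field L) :=
    continuous_slotGrad fun a => continuous_slotDeriv_zero _ (hZ a) hL
  have hG : ∀ α, MemLp (G α) 2 μ := fun α => memLp_slotGrad _ hZb (hGc α)
    (fun a p => inner_vertGrad_formFun _ p _ _) (hform α.1 α.2)
  have hg : MemLp (slotGrad Fr.slot Fr.field L) 2 μ := memLp_slotGrad _ hZb hgc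
    (fun a p => inner_vertGrad hL p _ _) hLfin
  obtain ⟨B, hB, hvar⟩ := exists_variation_bound hL hμ hcrit Fr.slot hZ
    (W := fun (l : Fin Fr.N × (Fin (k + 1) → Fin d)) j => Fr.Z (l.1, l.2 j))
    (fun l j => Fr.smooth _)
  have key : ∃ α : ℕ → S, Tendsto (fun m => eLpNorm (slotGrad Fr.slot Fr.field L - G (α m)) 2 μ)
      atTop (𝓝 0) := by
    refine exists_seq_tendsto_eLpNorm_sub hG (fun a b α β =>
        ⟨⟨DiffForm.lin a b α.1 β.1, α.2.lin a b β.2⟩, fun p => by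
          ext j
          exact slotDeriv_formFun_lin _ _ a b α.1 β.1 p⟩) hg
      (h := fun l : Fin Fr.N × (Fin (k + 1) → Fin d) => G ⟨Fr.form l.1 l.2, Fr.closed l.1 l.2⟩)
      (fun l => hG _) hB ?_
    intro F Y hFm hF hFG hYc hYs
    have hY : MemLp Y 2 μ := hYc.memLp_of_hasCompactSupport hYs
    have hd : MemLp (fun p => F p - Y p) 2 μ := hF.sub hY
    have hYa : ∀ a, Continuous fun p => Y p a := fun a =>
      (PiLp.continuous_apply 2 _ a).comp hYc
    have hYK : ∀ a p, p ∉ tsupport Y → Y p a = 0 := fun a p hp => by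
      rw [image_eq_zero_of_notMem_tsupport hp]
      rfl
    let η : (l : Fin Fr.N × (Fin (k + 1) → Fin d)) → TnM d (k + 1) M → ℝ := fun l p =>
      inner ℝ (F p - Y p) (G ⟨Fr.form l.1 l.2, Fr.closed l.1 l.2⟩ p)
    have hη : ∀ l, Integrable (η l) μ := fun l => integrable_inner_of_memLp hd (hG _)
    have hχ : ∀ l : Fin Fr.N, Continuous fun p : TnM d (k + 1) M => Fr.χ l p.proj := fun l =>
      (Fr.χ l).continuous.comp continuous_tnProj
    have hχb : ∀ (l : Fin Fr.N) (p : TnM d (k + 1) M), ‖Fr.χ l p.proj‖ ≤ 1 := fun l p => by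
      rw [Real.norm_of_nonneg (Fr.χ_mem l _).1]
      exact (Fr.χ_mem l _).2
    have hξ : ∀ l, Integrable (fun p => Fr.χ l.1 p.proj * η l p) μ := fun l =>
      (hη l).bdd_mul (hχ l.1).measurable.aestronglyMeasurable (Eventually.of_forall (hχb l.1))
    have hYint : ∀ {f : TnM d (k + 1) M → ℝ},
        (∀ a, Continuous fun p => slotDeriv (Fr.slot a) (Fr.field a) f p 0) →
        ∑ a, ∫ p, Y p a * slotDeriv (Fr.slot a) (Fr.field a) f p 0 ∂μ =
          ∫ p, inner ℝ (Y p) (slotGrad Fr.slot Fr.field f p) ∂μ := by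
      intro f hf
      rw [← integral_finsetSum _ fun a _ =>
        integrable_mul_of_support hYs (hYa a) (hYK a) (hf a)]
      simp only [inner_slotGrad]
    have h1 := hvar (fun a p => Y p a) (tsupport Y) (fun l p => Fr.χ l.1 p.proj * η l p) hYa hYs
      hYK (fun l => (hχ l.1).measurable.mul ((hFm.sub hYc.stronglyMeasurable).inner
        (hGc _).stronglyMeasurable).measurable) hξ ?_
    · rw [hYint fun a => continuous_slotDeriv_zero _ (hZ a) hL] at h1
      refine h1.trans (add_le_add_right (mul_le_mul_of_nonneg_left
        (Finset.sum_le_sum fun l _ => integral_mono (hξ l).abs (hη l).abs fun p => ?_) hB) _)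
      rw [abs_mul]
      exact mul_le_of_le_one_left (abs_nonneg _) (hχb l.1 p)
    · intro β hβ
      have hint : ∀ l : Fin Fr.N × (Fin (k + 1) → Fin d), Integrable (fun p =>
          Fr.χ l.1 p.proj * η l p *
            formFun β.toFun (tnSection (fun j => Fr.Z (l.1, l.2 j)) p.proj)) μ := by
        intro l
        have hc : Continuous fun x : M =>
            formFun β.toFun (tnSection (fun j => Fr.Z (l.1, l.2 j)) x) :=
          (continuous_formFun β).comp (continuous_tnSection fun j => Fr.smooth _)
        obtain ⟨b, hb⟩ := isCompact_univ.exists_bound_of_continuousOn hc.continuousOn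
        exact (hξ l).mul_bdd (hc.comp continuous_tnProj).measurable.aestronglyMeasurable
          (Eventually.of_forall fun p => hb p.proj trivial)
      rw [hYint fun a => continuous_slotDeriv_formFun _ (hZ a) β,
        ← integral_finsetSum _ fun l _ => hint l]
      have h2 : ∀ p, ∑ l : Fin Fr.N × (Fin (k + 1) → Fin d), Fr.χ l.1 p.proj * η l p *
          formFun β.toFun (tnSection (fun j => Fr.Z (l.1, l.2 j)) p.proj) =
          inner ℝ (F p) (G ⟨β, hβ⟩ p) - inner ℝ (Y p) (G ⟨β, hβ⟩ p) := fun p =>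
        (Fr.sum_mul_form β p (F p - Y p)).trans (inner_sub_left _ _ _)
      simp only [h2]
      rw [integral_sub (integrable_inner_of_memLp hF (hG _))
        (integrable_inner_of_memLp hY (hG _)), hFG ⟨β, hβ⟩, zero_sub]
      exact add_neg_cancel _
  obtain ⟨α, hα⟩ := key
  refine ⟨fun m => (α m).1, fun m => (α m).2, ?_⟩
  have h1 : Tendsto (fun m => ENNReal.ofReal |Fr.C| *
      eLpNorm (slotGrad Fr.slot Fr.field L - G (α m)) 2 μ ^ 2) atTop (𝓝 0) := by
    have h2 := ENNReal.Tendsto.const_mul (a := ENNReal.ofReal |Fr.C|)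
      (ENNReal.Tendsto.pow (n := 2) hα) (Or.inr ENNReal.ofReal_ne_top)
    simpa using h2
  exact tendsto_of_tendsto_of_tendsto_of_le_of_le tendsto_const_nhds h1
    (fun m => zero_le) fun m => sqNormH_sub_le Fr (fun a p => inner_vertGrad hL p _ _)
      fun a p => inner_vertGrad_formFun _ p _ _
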